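/- Let $G$ be a locally compact, $\sigma$-compact (Hausdorff) amenable group, and let $\mathcal{P}(G)$ denote the set of Radon probability measures on $G$, with the convolution $\int \varphi\,\mathrm{d}(h*F)=\iint \varphi(xy)\,\mathrm{d}h(x)\,\mathrm{d}F(y)$ and the total variation norm $\|\cdot\|$ on differences. A sequence $(F_N)\subset\mathcal{P}(G)$ is called a left Reiter sequence if $\|h*F_N-F_N\|\to 0$ as $N\to\infty$ for every $h\in\mathcal{P}(G)$. Let $(X,\mu)$ be a regular Borel probability space and let $T_1,T_2$ be two continuous measure-preserving actions of $G$ on $X$ that commute with each other, that is, $T_1^gT_2^h=T_2^hT_1^g$ for all $g,h\in G$. For $\epsilon\subseteq\{1,2\}$ and $\vec g=(g_1,g_2)\in G^2$ write $T_\epsilon^{\vec g}=\prod_{i\in\epsilon}T_i^{g_i}$ and $T_\epsilon^{\vec g}f=f\circ T_\epsilon^{\vec g}$ for functions $f$ on $X$. Then for any $f_\epsilon\in L^\infty(X,\mu)$, $\epsilon\subseteq\{1,2\}$, and any left Reiter sequences $\Phi=(\Phi_n)$, $\Psi=(\Psi_n)$ on $G$, the limit $$\lim_{n\to\infty}\iint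 \prod_{\epsilon\subseteq\{1,2\}}T_\epsilon^{\vec g}f_\epsilon\,\mathrm{d}\Phi_n(g_1)\,\mathrm{d}\Psi_n(g_2)$$ (of $L^2(X)$-valued integrals, which are well defined) exists in $L^2(X,\mu)$ and does not depend on $\Phi,\Psi$. -/

import Mathlib

open MeasureTheory Filter Topology
open scoped ENNReal

/-! ### Convolution of Radon probability measures and left Reiter sequences -/

section Reiter

variable {G : Type*} [Group G] [MeasurableSpace G]

/-- The convolution `h * F` of two Radon probability measures on a topological group,
`(h * F)(A) = ∫ F(x⁻¹ A) dh(x)`, so that `∫ φ d(h * F) = ∫ ∫ φ(x y) dF(y) dh(x)`.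
It is written as an average of translates, rather than as the image of the product measure under
multiplication, because in a group that is not second countable multiplication need not be
measurable for the product of the two Borel σ-algebras. -/
noncomputable def radonConv (h F : Measure G) : Measure G :=
  h.bind fun x => F.map (fun y => x * y)

instance radonConv_isFiniteMeasure (h F : Measure G) [IsFiniteMeasure h] [IsFiniteMeasure F] :
    IsFiniteMeasure (radonConv h F) := by
  refine ⟨lt_of_le_of_lt (Measure.bind_apply_le _ MeasurableSet.univ) ?_⟩
  calc ∫⁻ x, (F.map (fun y => x * y)) Set.univ ∂h
      ≤ ∫⁻ _, F Set.univ ∂h := by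
        refine lintegral_mono fun x => ?_
        by_cases hx : AEMeasurable (fun y => x * y) F
        · rw [Measure.map_apply_of_aemeasurable hx MeasurableSet.univ]
          simp
        · rw [Measure.map_of_not_aemeasurable hx]
          simp
    _ < ∞ := by
        rw [lintegral_const]
        exact ENNReal.mul_lt_top (measure_lt_top _ _) (measure_lt_top _ _)

/-- The total variation norm `‖μ - ν‖` of the difference of two finite measures. -/
noncomputable def totalVariationDist (μ ν : Measure G) [IsFiniteMeasure μ] [IsFiniteMeasure ν] :
    ℝ≥0∞ :=
  (μ.toSignedMeasure - ν.toSignedMeasure).totalVariation Set.univ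

variable [TopologicalSpace G]

/-- The family of translates that is averaged in `radonConv` is measurable, so that `radonConv`
is the convolution and no default value is involved. -/
theorem measurable_map_mul_left [IsTopologicalGroup G] [BorelSpace G]
    (F : Measure G) [IsProbabilityMeasure F] [F.Regular] :
    Measurable fun x : G => F.map (fun y => x * y) := by
  have hm : ∀ x : G, Measurable fun y : G => x * y := fun x => (continuous_const_mul x).measurable
  have hp : ∀ x : G, IsProbabilityMeasure (F.map (fun y => x * y)) :=
    fun x => Measure.isProbabilityMeasure_map (hm x).aemeasurable
  refine Measurable.measure_of_isPiSystem_of_isProbabilityMeasure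
    (S := {U : Set G | IsOpen U}) (BorelSpace.measurable_eq) isPiSystem_isOpen ?_
  intro U hU
  refine LowerSemicontinuous.measurable ?_
  intro x r hr
  change r < F.map (fun y => x * y) U at hr
  rw [Measure.map_apply (hm x) hU.measurableSet] at hr
  obtain ⟨K, hKU, hK, hrK⟩ :=
    Measure.Regular.innerRegular (hU.preimage (continuous_const_mul x)) r hr
  obtain ⟨V, W, hV, -, hxV, hKW, hVW⟩ :=
    generalized_tube_lemma (s := {x}) isCompact_singleton hK
      (n := (fun p : G × G => p.1 * p.2) ⁻¹' U) (hU.preimage continuous_mul)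
      (by
        rintro ⟨a, b⟩ ⟨ha, hb⟩
        obtain rfl : a = x := ha
        exact hKU hb)
  filter_upwards [hV.mem_nhds (hxV rfl)] with a ha
  change r < F.map (fun y => a * y) U
  rw [Measure.map_apply (hm a) hU.measurableSet]
  exact hrK.trans_le (measure_mono fun b hb => hVW (Set.mk_mem_prod ha (hKW hb)))

theorem radonConv_apply [IsTopologicalGroup G] [BorelSpace G]
    (h F : Measure G) [IsProbabilityMeasure F] [F.Regular] {A : Set G} (hA : MeasurableSet A) :
    radonConv h F A = ∫⁻ x, F ((fun y => x * y) ⁻¹' A) ∂h := by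
  rw [radonConv, Measure.bind_apply hA (measurable_map_mul_left F).aemeasurable]
  refine lintegral_congr fun x => ?_
  rw [Measure.map_apply (continuous_const_mul x).measurable hA]

/-- A left Reiter sequence: a sequence of Radon probability measures `F N` on `G` such that
`‖h * F N - F N‖ → 0` for every Radon probability measure `h` on `G`. -/
structure IsLeftReiter (F : ℕ → ProbabilityMeasure G) : Prop where
  regular : ∀ n, (F n : Measure G).Regular
  tendsto : ∀ h : ProbabilityMeasure G, (h : Measure G).Regular →
    Tendsto (fun n => totalVariationDist (radonConv (h : Measure G) (F n : Measure G))
      (F n : Measure G)) atTop (𝓝 0)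

end Reiter

/-! ### Tuples of commuting measure-preserving actions and cubic averages -/

section Systems

variable {G : Type*} [Group G] [TopologicalSpace G]
  {X : Type*} [TopologicalSpace X] [MeasurableSpace X]

/-- `T 0, …, T (k - 1)` are commuting continuous measure-preserving actions of the topological
group `G` on the topological space `X` with the Borel measure `μ`; `T i g` is the transformation
`T_{i+1}^g`. -/
structure IsCommutingSystem {k : ℕ} (T : Fin k → G → X → X) (μ : Measure X) : Prop where
  one : ∀ i x, T i 1 x = x
  mul : ∀ i g h x, T i (g * h) x = T i g (T i h x)
  continuous : ∀ i, Continuous fun p : G × X => T i p.1 p.2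
  measurePreserving : ∀ i g, MeasurePreserving (T i g) μ μ
  comm : ∀ i j, i ≠ j → ∀ g h x, T i g (T j h x) = T j h (T i g x)

/-- The transformation `T_ε^(g₁, g₂) = ∏_{i ∈ ε} T_i^{g_i}` for a set `ε` of indices; the indices
`1, 2` are the elements `0, 1` of `Fin 2`. -/
def faceMap (T : Fin 2 → G → X → X) (g : Fin 2 → G) (ε : Finset (Fin 2)) : X → X :=
  (if 0 ∈ ε then T 0 (g 0) else id) ∘ (if 1 ∈ ε then T 1 (g 1) else id)

variable {T : Fin 2 → G → X → X} {μ : Measure X}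

theorem IsCommutingSystem.measurePreserving_faceMap (hT : IsCommutingSystem T μ)
    (g : Fin 2 → G) (ε : Finset (Fin 2)) : MeasurePreserving (faceMap T g ε) μ μ := by
  unfold faceMap
  refine MeasurePreserving.comp (μb := μ) ?_ ?_
  · split_ifs
    · exact hT.measurePreserving 0 (g 0)
    · exact MeasurePreserving.id μ
  · split_ifs
    · exact hT.measurePreserving 1 (g 1)
    · exact MeasurePreserving.id μ

theorem IsCommutingSystem.memLp_prod [IsFiniteMeasure μ] (hT : IsCommutingSystem T μ)
    (f : Finset (Fin 2) → Lp ℂ ∞ μ) (g : Fin 2 → G) :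
    MemLp (fun x => ∏ ε : Finset (Fin 2), f ε (faceMap T g ε x)) 2 μ := by
  have h : MemLp (fun x => ∏ ε : Finset (Fin 2), f ε (faceMap T g ε x))
      (∑ _ε : Finset (Fin 2), (∞ : ℝ≥0∞)⁻¹)⁻¹ μ :=
    MemLp.prod' (f := fun (ε : Finset (Fin 2)) x => f ε (faceMap T g ε x)) fun ε _ => (Lp.memLp (f ε)).comp_measurePreserving
      (hT.measurePreserving_faceMap g ε)
  refine h.mono_exponent ?_
  simp

/-- The element `∏_{ε ⊆ {1,2}} T_ε^(g₁, g₂) f_ε` of `L²(X)`, where `T_ε^(g₁, g₂) f` is the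
composition of `f` with the transformation `T_ε^(g₁, g₂)`. -/
noncomputable def cubicProduct [IsFiniteMeasure μ] (hT : IsCommutingSystem T μ)
    (f : Finset (Fin 2) → Lp ℂ ∞ μ) (g : Fin 2 → G) : Lp ℂ 2 μ :=
  (hT.memLp_prod f g).toLp (fun x => ∏ ε : Finset (Fin 2), f ε (faceMap T g ε x))

variable [MeasurableSpace G]

/-- The cubic average `∬ ∏_{ε ⊆ {1,2}} T_ε^(g₁, g₂) f_ε dφ(g₁) dψ(g₂)`, an iterated Bochner
integral with values in `L²(X)`. -/
noncomputable def cubicAverage [IsFiniteMeasure μ] (hT : IsCommutingSystem T μ)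
    (f : Finset (Fin 2) → Lp ℂ ∞ μ) (φ ψ : Measure G) : Lp ℂ 2 μ :=
  ∫ g₂, ∫ g₁, cubicProduct hT f ![g₁, g₂] ∂φ ∂ψ

/-- Both Bochner integrals in the cubic average are integrals of integrable functions. -/
def CubicAverageWellDefined [IsFiniteMeasure μ] (hT : IsCommutingSystem T μ)
    (f : Finset (Fin 2) → Lp ℂ ∞ μ) (φ ψ : Measure G) : Prop :=
  (∀ g₂, Integrable (fun g₁ => cubicProduct hT f ![g₁, g₂]) φ) ∧
    Integrable (fun g₂ => ∫ g₁, cubicProduct hT f ![g₁, g₂] ∂φ) ψ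

end Systems

/-!
The factor `f_∅` comes out of the integrals, so the question concerns the trilinear averages
`A_n(f₁, f₂, v) = ∬ T₁^{g₁}f₁ · T₂^{g₂}f₂ · T₁^{g₁}T₂^{g₂}v dΦ_n(g₁) dΨ_n(g₂)`. They make sense for
bounded `f₁, f₂` and `v ∈ L²`, with `‖A_n‖ ≤ ‖f₁‖_∞ ‖f₂‖_∞ ‖v‖₂`, so for fixed `f₁, f₂` the `v` with
convergent averages form a closed subspace `N`, and it suffices that `Nᗮ ⊆ N`. The whole argument
takes place in the Hilbert space `L²`, with the two Koopman representations `U₁, U₂` and the algebra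
of multiplication operators (`CubicSystem`).

The main tool is a Hilbert space `K` of functions `G → L²`, with inner product the average over
the group of the pointwise inner products (`MeanSpace`). It contains the functions
`J_a v : g ↦ a · T₂^g v` (`CubicSystem.lift`), and `T₁` acts on it pointwise (`CubicSystem.rep`),
with `T₁^h J_a v = J_{T₁^h a} (T₁^h v)`. By the mean ergodic theorem for `T₂`, with `E`
the projection to the `T₂`-fixed functions, `J_b^* J_a c = c · E(b̄ a)`
(`CubicSystem.adjoint_lift_lift_vac`). The closed span of the `J_a c` is thus `L²` of the
relatively independent self-joining of `X` over the `T₂`-fixed factor; building it from functions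
on the group avoids disintegrations, which are not available because `X` need not be a standard
space.

* Structured vectors (`CubicSystem.hasReiterLimit_form_adjoint_lift`). If `η` is a `T₁`-fixed
  vector in that span, then `v = J_b^* η` satisfies `T₁^g v = J_{T₁^g b}^* η`. Approximating `η`
  by a combination of vectors `J_a c` approximates `A_n(f₁, f₂, v)`, uniformly in `n`, by averages
  in which the variables are separated: `∬ T₂^{g₂}(f₂ c) · q(g₁)` with
  `q(g₁) = T₁^{g₁}f₁ · E(a · T₁^{g₁}b̄) = J_{ā}^* T₁^{g₁} J_{b̄} f₁`.
  The mean ergodic theorem for `T₂` in `L²` and the one for `T₁` in `K` give convergence.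
* Pseudorandom vectors (`CubicSystem.hasReiterLimit_form_of_orthogonal`). If `v` is orthogonal to
  all structured vectors, then `J_{f₁} v` is orthogonal to the `T₁`-fixed vectors, so some finite
  average of its `T₁`-translates is small in `K`. As `Φ_n` is asymptotically invariant,
  `‖A_n(f₁, f₂, v)‖` is bounded in the limit by `‖f₂‖_∞` times the quadratic mean over `Ψ_n`
  of this finite average, that is, times its norm in `K`.

The mean ergodic theorem is used in the form that the closed convex hull of an orbit contains a
fixed vector, its point of minimal norm; only the invariance of Reiter sequences under point
masses enters. Since neither `G` nor `X` is assumed metrizable, strong continuity of the Koopman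
representations and continuity of the inner integral in the outer variable are derived from the
regularity of the measures.
-/

/-! ### Averages along Reiter sequences -/

section ReiterAverages

variable {G : Type*} [MeasurableSpace G] {E : Type*} [NormedAddCommGroup E]

/-- A continuous function on a σ-compact space has separable range, so second countability of the
group is not needed for strong measurability. -/
theorem Continuous.stronglyMeasurable_of_sigmaCompact [TopologicalSpace G] [SigmaCompactSpace G]
    [BorelSpace G] {c : G → E} (hc : Continuous c) : StronglyMeasurable c := by
  borelize E
  refine stronglyMeasurable_iff_measurable_separable.2 ⟨hc.measurable, ?_⟩
  obtain ⟨K, hK, hKr⟩ := isSigmaCompact_range hc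
  rw [← hKr]
  exact TopologicalSpace.IsSeparable.iUnion fun n => (hK n).isSeparable

theorem integrable_of_continuous_of_bounded [TopologicalSpace G] [SigmaCompactSpace G]
    [BorelSpace G] {c : G → E} (hc : Continuous c) {C : ℝ} (hC : ∀ g, ‖c g‖ ≤ C)
    (F : Measure G) [IsFiniteMeasure F] : Integrable c F :=
  Integrable.of_bound hc.stronglyMeasurable_of_sigmaCompact.aestronglyMeasurable C
    (Eventually.of_forall hC)

variable [NormedSpace ℝ E]

theorem norm_integral_le_of_bounded {c : G → E} {C : ℝ} (hC : ∀ g, ‖c g‖ ≤ C)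
    (F : Measure G) [IsProbabilityMeasure F] : ‖∫ g, c g ∂F‖ ≤ C := by
  simpa using norm_integral_le_of_norm_le_const (μ := F) (Eventually.of_forall hC)

theorem norm_integral_sub_integral_le_totalVariationDist {μ ν : Measure G} [IsFiniteMeasure μ]
    [IsFiniteMeasure ν] {c : G → E} (hc : StronglyMeasurable c) {C : ℝ} (hC : ∀ g, ‖c g‖ ≤ C) :
    ‖∫ g, c g ∂μ - ∫ g, c g ∂ν‖ ≤ C * (totalVariationDist μ ν).toReal := by
  set s := μ.toSignedMeasure - ν.toSignedMeasure with hs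
  set p := s.toJordanDecomposition.posPart
  set q := s.toJordanDecomposition.negPart
  have hspq : s = p.toSignedMeasure - q.toSignedMeasure :=
    s.toSignedMeasure_toJordanDecomposition.symm
  have hint : ∀ (m : Measure G) [IsFiniteMeasure m], Integrable c m := fun m _ =>
    Integrable.of_bound hc.aestronglyMeasurable C (Eventually.of_forall hC)
  have hadd : μ + q = ν + p := by
    rw [← Measure.toSignedMeasure_eq_toSignedMeasure_iff, Measure.toSignedMeasure_add,
      Measure.toSignedMeasure_add]
    have h := hs.symm.trans hspq
    rw [sub_eq_sub_iff_add_eq_add] at h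
    rw [h, add_comm]
  have h := congrArg (fun m => ∫ g, c g ∂m) hadd
  rw [integral_add_measure (hint _) (hint _), integral_add_measure (hint _) (hint _)] at h
  have h2 : ∫ g, c g ∂μ - ∫ g, c g ∂ν = ∫ g, c g ∂p - ∫ g, c g ∂q := by
    rw [sub_eq_sub_iff_add_eq_add, h, add_comm]
  rw [h2]
  calc ‖∫ g, c g ∂p - ∫ g, c g ∂q‖ ≤ ‖∫ g, c g ∂p‖ + ‖∫ g, c g ∂q‖ := norm_sub_le _ _
    _ ≤ C * p.real Set.univ + C * q.real Set.univ :=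
        add_le_add (norm_integral_le_of_norm_le_const (Eventually.of_forall hC))
          (norm_integral_le_of_norm_le_const (Eventually.of_forall hC))
    _ = C * (totalVariationDist μ ν).toReal := by
        rw [← mul_add]
        congr 1
        rw [totalVariationDist, ← hs, SignedMeasure.totalVariation, Measure.add_apply,
          ENNReal.toReal_add (measure_ne_top _ _) (measure_ne_top _ _)]
        rfl

theorem regular_dirac [TopologicalSpace G] [T1Space G] [BorelSpace G] (h : G) :
    (Measure.dirac h).Regular where
  lt_top_of_isCompact := fun _ _ => measure_lt_top _ _
  outerRegular := fun A hA r hr => by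
    by_cases hh : h ∈ A
    · exact ⟨Set.univ, Set.subset_univ A, isOpen_univ, by
        simpa [Measure.dirac_apply' _ hA, hh] using hr⟩
    · refine ⟨{h}ᶜ, fun x hx hxh => hh (hxh ▸ hx), isOpen_compl_singleton, ?_⟩
      rw [Measure.dirac_apply' _ isOpen_compl_singleton.measurableSet]
      simpa using bot_le.trans_lt hr
  innerRegular := fun U hU r hr => by
    by_cases hh : h ∈ U
    · refine ⟨{h}, Set.singleton_subset_iff.2 hh, isCompact_singleton, ?_⟩
      have : r < 1 := by simpa [Measure.dirac_apply' _ hU.measurableSet, hh] using hr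
      simpa using this
    · simp [Measure.dirac_apply' _ hU.measurableSet, hh] at hr

end ReiterAverages

section Translates

variable {G : Type*} [Group G] [MeasurableSpace G]

/-- The total variation norm of the difference of a measure and its left translate by `h`. -/
noncomputable def translateDist (h : G) (F : Measure G) [IsFiniteMeasure F] : ℝ :=
  (totalVariationDist (radonConv (Measure.dirac h) F) F).toReal

variable [TopologicalSpace G] [BorelSpace G]

theorem IsLeftReiter.tendsto_translateDist [T1Space G] {Φ : ℕ → ProbabilityMeasure G}
    (hΦ : IsLeftReiter Φ) (h : G) :
    Tendsto (fun n => translateDist h (Φ n : Measure G)) atTop (𝓝 0) := by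
  have := hΦ.tendsto ⟨Measure.dirac h, inferInstance⟩ (regular_dirac h)
  exact (ENNReal.tendsto_toReal ENNReal.zero_ne_top).comp this

theorem IsLeftReiter.tendsto_sum_translateDist [T1Space G] {Φ : ℕ → ProbabilityMeasure G}
    (hΦ : IsLeftReiter Φ) (s : Finset G) (σ : G → ℝ) :
    Tendsto (fun n => ∑ h ∈ s, σ h * translateDist h (Φ n : Measure G)) atTop (𝓝 0) := by
  simpa using tendsto_finsetSum s fun h _ => (hΦ.tendsto_translateDist h).const_mul (σ h)

variable [IsTopologicalGroup G] [SigmaCompactSpace G]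
  {E : Type*} [NormedAddCommGroup E] [NormedSpace ℝ E]

theorem norm_integral_translate_sub_le (h : G) (F : Measure G) [IsProbabilityMeasure F]
    [F.Regular] {c : G → E} (hc : Continuous c) {C : ℝ} (hC : ∀ g, ‖c g‖ ≤ C) :
    ‖∫ g, c (h * g) ∂F - ∫ g, c g ∂F‖ ≤ C * translateDist h F := by
  have hr : ∫ g, c g ∂(radonConv (Measure.dirac h) F) = ∫ g, c (h * g) ∂F := by
    rw [radonConv, Measure.dirac_bind (measurable_map_mul_left F),
      integral_map (continuous_const_mul h).measurable.aemeasurable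
      hc.stronglyMeasurable_of_sigmaCompact.aestronglyMeasurable]
  rw [← hr]
  exact norm_integral_sub_integral_le_totalVariationDist
    hc.stronglyMeasurable_of_sigmaCompact hC

/-- Averages along a Reiter sequence do not see a preliminary averaging over finitely many left
translates, with an error that depends on the function only through its supremum norm. -/
theorem norm_integral_sum_translate_sub_le (s : Finset G) (σ : G → ℝ)
    (hσ : ∀ h ∈ s, 0 ≤ σ h) (hσ1 : ∑ h ∈ s, σ h = 1) (F : Measure G) [IsProbabilityMeasure F]
    [F.Regular] {c : G → E} (hc : Continuous c) {C : ℝ} (hC : ∀ g, ‖c g‖ ≤ C) :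
    ‖∫ g, ∑ h ∈ s, σ h • c (h * g) ∂F - ∫ g, c g ∂F‖ ≤
      C * ∑ h ∈ s, σ h * translateDist h F := by
  have hi : ∀ h : G, Integrable (fun g => c (h * g)) F := fun h =>
    integrable_of_continuous_of_bounded (hc.comp (continuous_const_mul h)) (fun g => hC _) F
  have hsum : ∫ g, ∑ h ∈ s, σ h • c (h * g) ∂F = ∑ h ∈ s, σ h • ∫ g, c (h * g) ∂F := by
    rw [integral_finsetSum s fun h _ => (hi h).fun_smul (σ h)]
    simp only [integral_smul]
  have hone : ∫ g, c g ∂F = ∑ h ∈ s, σ h • ∫ g, c g ∂F := by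
    rw [← Finset.sum_smul, hσ1, one_smul]
  rw [hsum, hone, ← Finset.sum_sub_distrib, Finset.mul_sum]
  refine (norm_sum_le _ _).trans (Finset.sum_le_sum fun h hh => ?_)
  rw [← smul_sub, norm_smul, Real.norm_of_nonneg (hσ h hh)]
  calc σ h * _ ≤ σ h * (C * translateDist h F) :=
        mul_le_mul_of_nonneg_left (norm_integral_translate_sub_le h F hc hC) (hσ h hh)
    _ = _ := by ring

end Translates

section Parametric

variable {G : Type*} [MeasurableSpace G] [TopologicalSpace G] [BorelSpace G] [SigmaCompactSpace G]
  {Y : Type*} [TopologicalSpace Y]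
  {E : Type*} [NormedAddCommGroup E] [NormedSpace ℝ E]

/-- The integral of a bounded jointly continuous function against a Radon probability measure is
continuous in the parameter. The parameter space is not assumed first countable, so dominated
convergence is replaced by tightness and uniform convergence on compact sets. -/
theorem continuous_integral_of_bounded [T2Space G] (F : Measure G)
    [IsProbabilityMeasure F] [F.Regular]
    {c : G → Y → E} (hc : Continuous fun p : G × Y => c p.1 p.2) {C : ℝ}
    (hC : ∀ g y, ‖c g y‖ ≤ C) : Continuous fun y => ∫ g, c g y ∂F := by
  have hcg : ∀ y, Continuous fun g => c g y := fun y => by fun_prop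
  have hi : ∀ y, Integrable (fun g => c g y) F := fun y =>
    integrable_of_continuous_of_bounded (hcg y) (fun g => hC g y) F
  rw [continuous_iff_continuousAt]
  intro y₀
  rw [ContinuousAt, Metric.tendsto_nhds]
  intro ε hε
  have hC0 : 0 ≤ C := by
    obtain ⟨g⟩ : Nonempty G := Measure.nonempty_of_neZero F
    exact (norm_nonneg _).trans (hC g y₀)
  have hδ : 0 < ε / (4 * (C + 1)) := by positivity
  obtain ⟨K, -, hK, hKm⟩ := isOpen_univ.exists_lt_isCompact (μ := F)
    (r := 1 - ENNReal.ofReal (ε / (4 * (C + 1)))) (by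
      rw [measure_univ]
      exact ENNReal.sub_lt_self ENNReal.one_ne_top one_ne_zero
        (by simpa only [ne_eq, ENNReal.ofReal_eq_zero, not_le] using hδ))
  have hKc : F.real Kᶜ ≤ ε / (4 * (C + 1)) := by
    refine ENNReal.toReal_le_of_le_ofReal hδ.le ?_
    rw [prob_compl_eq_one_sub hK.measurableSet]
    exact tsub_le_iff_tsub_le.1 hKm.le
  have hnear : ∀ᶠ y in 𝓝 y₀, ∀ g ∈ K, ‖c g y - c g y₀‖ < ε / 4 := by
    refine hK.eventually_forall_of_forall_eventually (P := fun y g => ‖c g y - c g y₀‖ < ε / 4)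
      fun g _ => ?_
    have hcont : Continuous fun z : Y × G => ‖c z.2 z.1 - c z.2 y₀‖ := by
      have h1 : Continuous fun z : Y × G => c z.2 z.1 :=
        hc.comp (continuous_snd.prodMk continuous_fst)
      exact (h1.sub ((hcg y₀).comp continuous_snd)).norm
    exact (hcont.tendsto (y₀, g)).eventually (gt_mem_nhds (by simpa using by positivity))
  filter_upwards [hnear] with y hy
  rw [dist_eq_norm, ← integral_sub (hi y) (hi y₀)]
  have hbound : ∀ g, ‖c g y - c g y₀‖ ≤ ε / 4 + Kᶜ.indicator (fun _ => 2 * C) g := by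
    intro g
    by_cases hg : g ∈ K
    · simpa [hg] using (hy g hg).le
    · have := (norm_sub_le (c g y) (c g y₀)).trans (add_le_add (hC g y) (hC g y₀))
      simp only [Set.mem_compl_iff, hg, not_false_eq_true, Set.indicator_of_mem]
      linarith
  have hind : Integrable (Kᶜ.indicator fun _ => 2 * C) F :=
    (integrable_const _).indicator hK.measurableSet.compl
  calc ‖∫ g, (c g y - c g y₀) ∂F‖
      ≤ ∫ g, (ε / 4 + Kᶜ.indicator (fun _ => 2 * C) g) ∂F :=
        norm_integral_le_of_norm_le ((integrable_const _).add hind) (Eventually.of_forall hbound)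
    _ = ε / 4 + F.real Kᶜ * (2 * C) := by
        rw [integral_add (integrable_const _) hind, integral_indicator hK.measurableSet.compl]
        simp
    _ ≤ ε / 4 + ε / (4 * (C + 1)) * (2 * C) := by gcongr
    _ < ε := by
        have : ε / (4 * (C + 1)) * (2 * C) ≤ ε / 2 := by
          rw [div_mul_eq_mul_div, div_le_div_iff₀ (by positivity) (by positivity)]
          nlinarith
        linarith

end Parametric

/-! ### Double averages along Reiter sequences -/

section DoubleAverages

variable {G : Type*} [MeasurableSpace G] {E : Type*} [NormedAddCommGroup E]

theorem integrable_fst_of_bounded [TopologicalSpace G] [SigmaCompactSpace G] [BorelSpace G]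
    (φ : Measure G) [IsProbabilityMeasure φ] {F : G → G → E}
    (hF : Continuous fun p : G × G => F p.1 p.2) {C : ℝ} (hC : ∀ g₁ g₂, ‖F g₁ g₂‖ ≤ C) (g₂ : G) :
    Integrable (fun g₁ => F g₁ g₂) φ :=
  integrable_of_continuous_of_bounded
    (hF.comp (continuous_id.prodMk continuous_const)) (fun g₁ => hC g₁ g₂) φ

variable [NormedSpace ℝ E]

/-- The iterated average of a function of two group variables. -/
noncomputable def doubleAverage (φ ψ : Measure G) (F : G → G → E) : E :=
  ∫ g₂, ∫ g₁, F g₁ g₂ ∂φ ∂ψ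

theorem norm_doubleAverage_le (φ ψ : Measure G) [IsProbabilityMeasure φ] [IsProbabilityMeasure ψ]
    {F : G → G → E} {C : ℝ} (hC : ∀ g₁ g₂, ‖F g₁ g₂‖ ≤ C) : ‖doubleAverage φ ψ F‖ ≤ C :=
  norm_integral_le_of_bounded (fun g₂ => norm_integral_le_of_bounded (fun g₁ => hC g₁ g₂) φ) ψ

variable [TopologicalSpace G] [T2Space G] [SigmaCompactSpace G] [BorelSpace G]

theorem integrable_snd_of_bounded (φ ψ : Measure G) [IsProbabilityMeasure φ] [φ.Regular]
    [IsProbabilityMeasure ψ] {F : G → G → E}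
    (hF : Continuous fun p : G × G => F p.1 p.2) {C : ℝ} (hC : ∀ g₁ g₂, ‖F g₁ g₂‖ ≤ C) :
    Integrable (fun g₂ => ∫ g₁, F g₁ g₂ ∂φ) ψ :=
  integrable_of_continuous_of_bounded (continuous_integral_of_bounded φ hF hC)
    (fun g₂ => norm_integral_le_of_bounded (fun g₁ => hC g₁ g₂) φ) ψ

theorem doubleAverage_add (φ ψ : Measure G) [IsProbabilityMeasure φ] [φ.Regular]
    [IsProbabilityMeasure ψ] {F F' : G → G → E}
    (hF : Continuous fun p : G × G => F p.1 p.2) {C : ℝ} (hC : ∀ g₁ g₂, ‖F g₁ g₂‖ ≤ C)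
    (hF' : Continuous fun p : G × G => F' p.1 p.2) {C' : ℝ} (hC' : ∀ g₁ g₂, ‖F' g₁ g₂‖ ≤ C') :
    doubleAverage φ ψ (fun g₁ g₂ => F g₁ g₂ + F' g₁ g₂) =
      doubleAverage φ ψ F + doubleAverage φ ψ F' := by
  unfold doubleAverage
  rw [← integral_add (integrable_snd_of_bounded φ ψ hF hC)
    (integrable_snd_of_bounded φ ψ hF' hC')]
  refine integral_congr_ae (Eventually.of_forall fun g₂ => ?_)
  exact integral_add (integrable_fst_of_bounded φ hF hC g₂)
    (integrable_fst_of_bounded φ hF' hC' g₂)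

theorem doubleAverage_sub (φ ψ : Measure G) [IsProbabilityMeasure φ] [φ.Regular]
    [IsProbabilityMeasure ψ] {F F' : G → G → E}
    (hF : Continuous fun p : G × G => F p.1 p.2) {C : ℝ} (hC : ∀ g₁ g₂, ‖F g₁ g₂‖ ≤ C)
    (hF' : Continuous fun p : G × G => F' p.1 p.2) {C' : ℝ} (hC' : ∀ g₁ g₂, ‖F' g₁ g₂‖ ≤ C') :
    doubleAverage φ ψ (fun g₁ g₂ => F g₁ g₂ - F' g₁ g₂) =
      doubleAverage φ ψ F - doubleAverage φ ψ F' := by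
  unfold doubleAverage
  rw [← integral_sub (integrable_snd_of_bounded φ ψ hF hC)
    (integrable_snd_of_bounded φ ψ hF' hC')]
  refine integral_congr_ae (Eventually.of_forall fun g₂ => ?_)
  exact integral_sub (integrable_fst_of_bounded φ hF hC g₂)
    (integrable_fst_of_bounded φ hF' hC' g₂)

theorem ContinuousLinearMap.doubleAverage_comp_comm {E' : Type*} [NormedAddCommGroup E']
    [NormedSpace ℝ E'] [CompleteSpace E] [CompleteSpace E'] (L : E →L[ℝ] E') (φ ψ : Measure G)
    [IsProbabilityMeasure φ] [φ.Regular] [IsProbabilityMeasure ψ] {F : G → G → E}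
    (hF : Continuous fun p : G × G => F p.1 p.2) {C : ℝ} (hC : ∀ g₁ g₂, ‖F g₁ g₂‖ ≤ C) :
    doubleAverage φ ψ (fun g₁ g₂ => L (F g₁ g₂)) = L (doubleAverage φ ψ F) := by
  unfold doubleAverage
  rw [← L.integral_comp_comm (integrable_snd_of_bounded φ ψ hF hC)]
  refine integral_congr_ae (Eventually.of_forall fun g₂ => ?_)
  exact L.integral_comp_comm (integrable_fst_of_bounded φ hF hC g₂)

end DoubleAverages

section HasReiterLimit

variable {G : Type*} [Group G] [TopologicalSpace G] [MeasurableSpace G]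
  {E : Type*} [NormedAddCommGroup E] [NormedSpace ℝ E]

/-- A bounded continuous function of two group variables whose double averages converge along all
pairs of Reiter sequences, to a limit independent of the sequences. Convergence is encoded by
approximate limits (equivalent to a limit in a complete space as soon as a Reiter sequence exists),
which makes the property visibly stable under uniform approximation. -/
structure HasReiterLimit (F : G → G → E) : Prop where
  continuous : Continuous fun p : G × G => F p.1 p.2
  bounded : ∃ C, ∀ g₁ g₂, ‖F g₁ g₂‖ ≤ C
  eventually_near : ∀ ε > 0, ∃ L, ∀ Φ Ψ : ℕ → ProbabilityMeasure G, IsLeftReiter Φ →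
    IsLeftReiter Ψ →
    ∀ᶠ n in atTop, ‖doubleAverage (Φ n : Measure G) (Ψ n : Measure G) F - L‖ ≤ ε

namespace HasReiterLimit

theorem of_tendsto {F : G → G → E} (hF : Continuous fun p : G × G => F p.1 p.2) {C : ℝ}
    (hC : ∀ g₁ g₂, ‖F g₁ g₂‖ ≤ C) (L : E)
    (hL : ∀ Φ Ψ : ℕ → ProbabilityMeasure G, IsLeftReiter Φ → IsLeftReiter Ψ →
      Tendsto (fun n => doubleAverage (Φ n : Measure G) (Ψ n : Measure G) F) atTop (𝓝 L)) :
    HasReiterLimit F where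
  continuous := hF
  bounded := ⟨C, hC⟩
  eventually_near _ hε := ⟨L, fun Φ Ψ hΦ hΨ =>
    ((tendsto_iff_norm_sub_tendsto_zero.1 (hL Φ Ψ hΦ hΨ)).eventually (gt_mem_nhds hε)).mono
      fun _ h => h.le⟩

/-- The sequences of double averages along all pairs of Reiter sequences generate a Cauchy
filter, so in a complete space they have a common limit. -/
theorem exists_tendsto [CompleteSpace E] {F : G → G → E} (hF : HasReiterLimit F)
    {Φ₀ : ℕ → ProbabilityMeasure G} (hΦ₀ : IsLeftReiter Φ₀) :
    ∃ L, ∀ Φ Ψ : ℕ → ProbabilityMeasure G, IsLeftReiter Φ → IsLeftReiter Ψ →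
      Tendsto (fun n => doubleAverage (Φ n : Measure G) (Ψ n : Measure G) F) atTop (𝓝 L) := by
  let l : Filter E := ⨆ (Φ : ℕ → ProbabilityMeasure G) (Ψ : ℕ → ProbabilityMeasure G)
    (_ : IsLeftReiter Φ) (_ : IsLeftReiter Ψ),
    map (fun n => doubleAverage (Φ n : Measure G) (Ψ n : Measure G) F) atTop
  have hle : ∀ Φ Ψ : ℕ → ProbabilityMeasure G, IsLeftReiter Φ → IsLeftReiter Ψ →
      map (fun n => doubleAverage (Φ n : Measure G) (Ψ n : Measure G) F) atTop ≤ l :=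
    fun Φ Ψ hΦ hΨ => le_iSup₂_of_le Φ Ψ (le_iSup₂_of_le hΦ hΨ le_rfl)
  have hl : Cauchy l := by
    refine Metric.cauchy_iff.2 ⟨NeBot.mono inferInstance (hle Φ₀ Φ₀ hΦ₀ hΦ₀), fun ε hε => ?_⟩
    obtain ⟨L, hL⟩ := hF.eventually_near (ε / 3) (by positivity)
    refine ⟨Metric.closedBall L (ε / 3), ?_, fun x hx y hy => ?_⟩
    · simp only [l, mem_iSup, mem_map]
      intro Φ Ψ hΦ hΨ
      filter_upwards [hL Φ Ψ hΦ hΨ] with n hn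
      rwa [Set.mem_preimage, mem_closedBall_iff_norm]
    · have := dist_triangle_right x y L
      rw [Metric.mem_closedBall] at hx hy
      linarith
  obtain ⟨L, hL⟩ := CompleteSpace.complete hl
  exact ⟨L, fun Φ Ψ hΦ hΨ => (hle Φ Ψ hΦ hΨ).trans hL⟩

variable [T2Space G] [SigmaCompactSpace G] [BorelSpace G]

theorem add {F F' : G → G → E} (hF : HasReiterLimit F) (hF' : HasReiterLimit F') :
    HasReiterLimit fun g₁ g₂ => F g₁ g₂ + F' g₁ g₂ where
  continuous := hF.continuous.add hF'.continuous
  bounded := by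
    obtain ⟨C, hC⟩ := hF.bounded
    obtain ⟨C', hC'⟩ := hF'.bounded
    exact ⟨C + C', fun g₁ g₂ => (norm_add_le _ _).trans (add_le_add (hC _ _) (hC' _ _))⟩
  eventually_near ε hε := by
    obtain ⟨C, hC⟩ := hF.bounded
    obtain ⟨C', hC'⟩ := hF'.bounded
    obtain ⟨L, hL⟩ := hF.eventually_near (ε / 2) (half_pos hε)
    obtain ⟨L', hL'⟩ := hF'.eventually_near (ε / 2) (half_pos hε)
    refine ⟨L + L', fun Φ Ψ hΦ hΨ => ?_⟩
    filter_upwards [hL Φ Ψ hΦ hΨ, hL' Φ Ψ hΦ hΨ] with n hn hn'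
    have := hΦ.regular n
    rw [doubleAverage_add _ _ hF.continuous hC hF'.continuous hC', add_sub_add_comm]
    exact (norm_add_le _ _).trans (by linarith)

theorem clm_comp [CompleteSpace E] {E' : Type*} [NormedAddCommGroup E'] [NormedSpace ℝ E']
    [CompleteSpace E'] {F : G → G → E} (hF : HasReiterLimit F) (L : E →L[ℝ] E') :
    HasReiterLimit fun g₁ g₂ => L (F g₁ g₂) where
  continuous := L.continuous.comp hF.continuous
  bounded := by
    obtain ⟨C, hC⟩ := hF.bounded
    exact ⟨‖L‖ * C, fun g₁ g₂ => L.le_opNorm_of_le (hC _ _)⟩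
  eventually_near ε hε := by
    obtain ⟨C, hC⟩ := hF.bounded
    obtain ⟨a, ha⟩ := hF.eventually_near (ε / (‖L‖ + 1)) (by positivity)
    refine ⟨L a, fun Φ Ψ hΦ hΨ => ?_⟩
    filter_upwards [ha Φ Ψ hΦ hΨ] with n hn
    have := hΦ.regular n
    rw [L.doubleAverage_comp_comm _ _ hF.continuous hC, ← map_sub]
    refine (L.le_opNorm_of_le hn).trans ?_
    rw [mul_div_assoc', div_le_iff₀ (by positivity)]
    nlinarith [norm_nonneg L]

theorem of_approx {F : G → G → E}
    (h : ∀ ε > 0, ∃ F', HasReiterLimit F' ∧ ∀ g₁ g₂, ‖F g₁ g₂ - F' g₁ g₂‖ ≤ ε) :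
    HasReiterLimit F := by
  have hcont : Continuous fun p : G × G => F p.1 p.2 := by
    refine continuous_of_uniform_approx_of_continuous fun u hu => ?_
    obtain ⟨ε, hε, hεu⟩ := Metric.mem_uniformity_dist.1 hu
    obtain ⟨F', hF', hFF'⟩ := h (ε / 2) (half_pos hε)
    refine ⟨fun p => F' p.1 p.2, hF'.continuous, fun p => hεu ?_⟩
    rw [dist_eq_norm]
    exact (hFF' _ _).trans_lt (half_lt_self hε)
  have hbdd : ∃ C, ∀ g₁ g₂, ‖F g₁ g₂‖ ≤ C := by
    obtain ⟨F', hF', hFF'⟩ := h 1 one_pos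
    obtain ⟨C, hC⟩ := hF'.bounded
    refine ⟨1 + C, fun g₁ g₂ => ?_⟩
    calc ‖F g₁ g₂‖ = ‖(F g₁ g₂ - F' g₁ g₂) + F' g₁ g₂‖ := by rw [sub_add_cancel]
      _ ≤ 1 + C := (norm_add_le _ _).trans (add_le_add (hFF' _ _) (hC _ _))
  refine ⟨hcont, hbdd, fun ε hε => ?_⟩
  obtain ⟨C, hC⟩ := hbdd
  obtain ⟨F', hF', hFF'⟩ := h (ε / 2) (half_pos hε)
  obtain ⟨C', hC'⟩ := hF'.bounded
  obtain ⟨L, hL⟩ := hF'.eventually_near (ε / 2) (half_pos hε)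
  refine ⟨L, fun Φ Ψ hΦ hΨ => ?_⟩
  filter_upwards [hL Φ Ψ hΦ hΨ] with n hn
  have := hΦ.regular n
  have h1 := norm_doubleAverage_le (Φ n : Measure G) (Ψ n : Measure G) hFF'
  rw [doubleAverage_sub _ _ hcont hC hF'.continuous hC'] at h1
  calc _ = ‖(doubleAverage (Φ n : Measure G) (Ψ n : Measure G) F -
        doubleAverage (Φ n : Measure G) (Ψ n : Measure G) F') +
        (doubleAverage (Φ n : Measure G) (Ψ n : Measure G) F' - L)‖ := by rw [sub_add_sub_cancel]
    _ ≤ ε := (norm_add_le _ _).trans (by linarith)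

variable {E' K : Type*} [NormedAddCommGroup E'] [NormedSpace ℂ E'] [CompleteSpace E']
  [NormedAddCommGroup K] [NormedSpace ℂ K]

/-- The vectors at which a given family of operators has a Reiter limit. -/
def submodule (Λ : G → G → K →L[ℂ] E') : Submodule ℂ K where
  carrier := {η | HasReiterLimit fun g₁ g₂ => Λ g₁ g₂ η}
  add_mem' {x y} hx hy := by
    simpa only [Set.mem_ofPred_eq, map_add] using HasReiterLimit.add hx hy
  zero_mem' := by
    refine of_tendsto (by simpa using continuous_const) (C := 0) (by simp) 0 fun Φ Ψ _ _ => ?_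
    simp [doubleAverage]
  smul_mem' c x hx := by
    simpa using hx.clm_comp ((c • ContinuousLinearMap.id ℂ E').restrictScalars ℝ)

theorem isClosed_submodule {Λ : G → G → K →L[ℂ] E'} {C : ℝ} (hC : ∀ g₁ g₂, ‖Λ g₁ g₂‖ ≤ C) :
    IsClosed (submodule Λ : Set K) := by
  refine isClosed_of_closure_subset fun x hx => of_approx fun ε hε => ?_
  have hC0 : 0 ≤ C := (norm_nonneg _).trans (hC 1 1)
  obtain ⟨y, hy, hxy⟩ := Metric.mem_closure_iff.1 hx (ε / (C + 1)) (by positivity)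
  refine ⟨_, hy, fun g₁ g₂ => ?_⟩
  rw [← map_sub]
  rw [dist_eq_norm] at hxy
  calc _ ≤ C * (ε / (C + 1)) := (Λ g₁ g₂).le_of_opNorm_le_of_le (hC _ _) hxy.le
    _ ≤ ε := by
        rw [mul_div_assoc', div_le_iff₀ (by positivity)]
        nlinarith

end HasReiterLimit

end HasReiterLimit

/-! ### Mean ergodic theorem -/

/-- Finite averages of an orbit, hence also their limits, have the same inner product with a fixed
vector as the starting point of the orbit. -/
theorem inner_eq_of_mem_closure_averages {G K : Type*} [NormedAddCommGroup K]
    [InnerProductSpace ℂ K] {V : G → K →ₗᵢ[ℂ] K} {ξ m w : K} (hw : ∀ g, V g w = w)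
    (hm : ∀ ε > 0, ∃ (s : Finset G) (σ : G → ℝ), (∀ h ∈ s, 0 ≤ σ h) ∧
      ∑ h ∈ s, σ h = 1 ∧ ‖∑ h ∈ s, σ h • V h ξ - m‖ < ε) :
    inner ℂ w ξ = inner ℂ w m := by
  refine eq_of_forall_dist_le fun ε hε => ?_
  obtain ⟨s, σ, -, h1, hs⟩ := hm (ε / (‖w‖ + 1)) (by positivity)
  have havg : inner ℂ w (∑ h ∈ s, σ h • V h ξ) = inner ℂ w ξ := by
    have : ∀ h, inner ℂ w (V h ξ) = inner ℂ w ξ := fun h => by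
      conv_lhs => rw [← hw h]
      exact (V h).inner_map_map w ξ
    simp only [inner_sum, ← Complex.coe_smul, inner_smul_right, this]
    rw [← Finset.sum_mul, ← Complex.ofReal_sum, h1, Complex.ofReal_one, one_mul]
  rw [dist_eq_norm, ← havg, ← inner_sub_right]
  calc _ ≤ ‖w‖ * (ε / (‖w‖ + 1)) :=
        (norm_inner_le_norm _ _).trans (mul_le_mul_of_nonneg_left hs.le (norm_nonneg _))
    _ ≤ ε := by
        rw [mul_div_assoc', div_le_iff₀ (by positivity)]
        nlinarith [norm_nonneg w]

section MeanErgodic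

variable {G : Type*} [Group G] {K : Type*} [NormedAddCommGroup K] [InnerProductSpace ℂ K]

/-- The point of minimal norm of the closed convex hull of an orbit is fixed, by uniqueness. -/
theorem exists_fixed_of_isometries [CompleteSpace K] (V : G → K →ₗᵢ[ℂ] K)
    (hV : ∀ g h ξ, V (g * h) ξ = V h (V g ξ)) (ξ : K) :
    ∃ m, (∀ g, V g m = m) ∧ ∀ ε > 0, ∃ (s : Finset G) (σ : G → ℝ), (∀ h ∈ s, 0 ≤ σ h) ∧
      ∑ h ∈ s, σ h = 1 ∧ ‖∑ h ∈ s, σ h • V h ξ - m‖ < ε := by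
  let : InnerProductSpace ℝ K := InnerProductSpace.complexToReal
  set D : Set K := convexHull ℝ (Set.range fun g => V g ξ) with hD
  have hDc : Convex ℝ (closure D) := (convex_convexHull ℝ _).closure
  have hDV : ∀ g, ∀ x ∈ closure D, V g x ∈ closure D := by
    intro g x hx
    refine map_mem_closure (V g).continuous hx fun y hy => ?_
    have : (fun z => V g z) '' D ⊆ D := by
      have h := ((V g).toLinearMap.restrictScalars ℝ).image_convexHull (Set.range fun g => V g ξ)
      refine (h.le.trans (convexHull_mono ?_) : _)
      rintro _ ⟨_, ⟨h, rfl⟩, rfl⟩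
      exact ⟨h * g, hV h g ξ⟩
    exact this ⟨y, hy, rfl⟩
  have hne : (closure D).Nonempty := ⟨V 1 ξ, subset_closure (subset_convexHull ℝ _ ⟨1, rfl⟩)⟩
  obtain ⟨m, hm, hmin⟩ :=
    exists_norm_eq_iInf_of_complete_convex hne isClosed_closure.isComplete hDc 0
  refine ⟨m, fun g => ?_, fun ε hε => ?_⟩
  · -- `V g m` lies in the same convex set, so the variational inequality at `m` applies to it;
    -- as it has the norm of `m`, it is `m`
    have h := (norm_eq_iInf_iff_real_inner_le_zero hDc hm).1 hmin (V g m) (hDV g m hm)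
    have h2 : ‖V g m - m‖ ^ 2 ≤ 0 := by
      rw [norm_sub_sq_real, (V g).norm_map]
      rw [zero_sub, inner_neg_left, inner_sub_right, real_inner_self_eq_norm_sq] at h
      rw [real_inner_comm]
      linarith
    exact sub_eq_zero.1 (norm_eq_zero.1 (pow_eq_zero_iff two_ne_zero |>.1
      (le_antisymm h2 (sq_nonneg _))))
  · obtain ⟨y, hy, hmy⟩ := Metric.mem_closure_iff.1 hm ε hε
    rw [hD, convexHull_range_eq_exists_affineCombination] at hy
    obtain ⟨s, σ, h0, h1, rfl⟩ := hy
    refine ⟨s, σ, h0, h1, ?_⟩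
    rw [dist_comm, dist_eq_norm, s.affineCombination_eq_linear_combination _ _ h1] at hmy
    exact hmy

variable [TopologicalSpace G] [IsTopologicalGroup G] [T2Space G] [SigmaCompactSpace G]
  [MeasurableSpace G] [BorelSpace G]

/-- Mean ergodic theorem along Reiter sequences. The representation itself is not assumed
continuous, only the observed function `g ↦ L (V g ξ)` is. -/
theorem tendsto_integral_of_fixed {V : G → K →ₗᵢ[ℂ] K}
    (hV : ∀ g h ξ, V (g * h) ξ = V h (V g ξ)) {ξ m : K} (hm : ∀ g, V g m = m)
    (hmξ : ∀ ε > 0, ∃ (s : Finset G) (σ : G → ℝ), (∀ h ∈ s, 0 ≤ σ h) ∧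
      ∑ h ∈ s, σ h = 1 ∧ ‖∑ h ∈ s, σ h • V h ξ - m‖ < ε)
    {E : Type*} [NormedAddCommGroup E] [NormedSpace ℂ E] [CompleteSpace E] (L : K →L[ℂ] E)
    (hc : Continuous fun g => L (V g ξ))
    {Φ : ℕ → ProbabilityMeasure G} (hΦ : IsLeftReiter Φ) :
    Tendsto (fun n => ∫ g, L (V g ξ) ∂(Φ n : Measure G)) atTop (𝓝 (L m)) := by
  rw [Metric.tendsto_nhds]
  intro ε hε
  obtain ⟨s, σ, h0, h1, hs⟩ := hmξ (ε / (2 * (‖L‖ + 1))) (by positivity)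
  have hC : ∀ g, ‖L (V g ξ)‖ ≤ ‖L‖ * ‖ξ‖ := fun g => L.le_opNorm_of_le ((V g).norm_map ξ).le
  have hlim := (hΦ.tendsto_sum_translateDist s σ).const_mul (‖L‖ * ‖ξ‖)
  rw [mul_zero] at hlim
  filter_upwards [hlim.eventually (gt_mem_nhds (half_pos hε))] with n hn
  have := hΦ.regular n
  have h2 := norm_integral_sum_translate_sub_le s σ h0 h1 (Φ n : Measure G) hc hC
  -- the finite average of the orbit is close to `m`, uniformly after applying any `V g`
  have hnear : ∀ g, ‖∑ h ∈ s, σ h • L (V (h * g) ξ) - L m‖ ≤ ε / 2 := by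
    intro g
    have : ∑ h ∈ s, σ h • L (V (h * g) ξ) - L m =
        L (V g (∑ h ∈ s, σ h • V h ξ - m)) := by
      rw [map_sub, map_sub, hm, map_sum, map_sum]
      congr 1
      refine Finset.sum_congr rfl fun h _ => ?_
      rw [hV, ← Complex.coe_smul, ← Complex.coe_smul, map_smul, map_smul]
    rw [this]
    calc _ ≤ ‖L‖ * (ε / (2 * (‖L‖ + 1))) :=
          L.le_opNorm_of_le (((V g).norm_map _).trans_le hs.le)
      _ ≤ ε / 2 := by
          rw [mul_div_assoc', div_le_div_iff₀ (by positivity) (by positivity)]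
          nlinarith [norm_nonneg L]
  have hi : Integrable (fun g => ∑ h ∈ s, σ h • L (V (h * g) ξ)) (Φ n : Measure G) :=
    integrable_finsetSum s fun h _ => (integrable_of_continuous_of_bounded
      (hc.comp (continuous_const_mul h)) (fun g => hC _) _).fun_smul (σ h)
  have h3 : ‖∫ g, ∑ h ∈ s, σ h • L (V (h * g) ξ) ∂(Φ n : Measure G) - L m‖ ≤ ε / 2 := by
    have := norm_integral_le_of_bounded hnear (Φ n : Measure G)
    rwa [integral_sub hi (integrable_const _), integral_const, probReal_univ, one_smul] at this
  rw [dist_eq_norm]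
  calc _ = ‖(∫ g, ∑ h ∈ s, σ h • L (V (h * g) ξ) ∂(Φ n : Measure G) - L m) -
        (∫ g, ∑ h ∈ s, σ h • L (V (h * g) ξ) ∂(Φ n : Measure G) -
          ∫ g, L (V g ξ) ∂(Φ n : Measure G))‖ := by congr 1; abel
    _ < ε := (norm_sub_le _ _).trans_lt (by linarith)

end MeanErgodic

/-! ### The Hilbert space of functions modulo an ultralimit of averages -/

section MeanSpace

open BoundedContinuousFunction

/-- The limit of a bounded sequence of complex numbers along a fixed nonprincipal ultrafilter. -/
noncomputable def ultraLim (u : ℕ → ℂ) : ℂ :=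
  limUnder (hyperfilter ℕ : Filter ℕ) u

theorem tendsto_ultraLim {u : ℕ → ℂ} {C : ℝ} (hC : ∀ n, ‖u n‖ ≤ C) :
    Tendsto u (hyperfilter ℕ : Filter ℕ) (𝓝 (ultraLim u)) := by
  have hu : ((hyperfilter ℕ).map u : Filter ℂ) ≤ 𝓟 (Metric.closedBall 0 C) := by
    rw [le_principal_iff]
    exact Ultrafilter.mem_map.2 (Filter.Eventually.of_forall fun n => by simpa using hC n)
  obtain ⟨z, -, hz⟩ := (isCompact_closedBall (0 : ℂ) C).ultrafilter_le_nhds _ hu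
  exact tendsto_nhds_limUnder ⟨z, hz⟩

theorem ultraLim_eq_of_tendsto {u : ℕ → ℂ} {z : ℂ} (hu : Tendsto u atTop (𝓝 z)) :
    ultraLim u = z :=
  (hu.mono_left Nat.hyperfilter_le_atTop).limUnder_eq

variable {G : Type*} [TopologicalSpace G] [MeasurableSpace G]
  (Ψ : ℕ → ProbabilityMeasure G) (H : Type*) [NormedAddCommGroup H] [InnerProductSpace ℂ H]

/-- Bounded continuous functions `G → H`, to be equipped with the semi-inner product that averages
the pointwise inner products along `Ψ` and an ultrafilter. -/
def MeanSpace (_Ψ : ℕ → ProbabilityMeasure G) (H : Type*) [NormedAddCommGroup H]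
    [InnerProductSpace ℂ H] : Type _ :=
  G →ᵇ H

noncomputable instance : AddCommGroup (MeanSpace Ψ H) := inferInstanceAs (AddCommGroup (G →ᵇ H))

noncomputable instance : Module ℂ (MeanSpace Ψ H) := inferInstanceAs (Module ℂ (G →ᵇ H))

instance : FunLike (MeanSpace Ψ H) G H := inferInstanceAs (FunLike (G →ᵇ H) G H)

variable {Ψ H}

namespace MeanSpace

theorem continuous (x : MeanSpace Ψ H) : Continuous x := BoundedContinuousFunction.continuous x

theorem exists_bound (x : MeanSpace Ψ H) : ∃ C, ∀ g, ‖x g‖ ≤ C :=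
  ⟨_, fun g => BoundedContinuousFunction.norm_coe_le_norm x g⟩

@[simp] theorem add_apply (x y : MeanSpace Ψ H) (g : G) : (x + y) g = x g + y g := rfl

@[simp] theorem smul_apply (c : ℂ) (x : MeanSpace Ψ H) (g : G) : (c • x) g = c • x g := rfl

/-- The element of `MeanSpace Ψ H` given by a bounded continuous function. -/
noncomputable def mk (x : G → H) (hx : Continuous x) (hb : ∃ C, ∀ g, ‖x g‖ ≤ C) : MeanSpace Ψ H :=
  BoundedContinuousFunction.ofNormedAddCommGroup x hx hb.choose hb.choose_spec

@[simp] theorem mk_apply (x : G → H) (hx : Continuous x) (hb : ∃ C, ∀ g, ‖x g‖ ≤ C) (g : G) :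
    (mk x hx hb : MeanSpace Ψ H) g = x g := rfl

@[ext] theorem ext {x y : MeanSpace Ψ H} (h : ∀ g, x g = y g) : x = y :=
  BoundedContinuousFunction.ext h

theorem continuous_inner (x y : MeanSpace Ψ H) : Continuous fun g => inner ℂ (x g) (y g) :=
  x.continuous.inner y.continuous

theorem exists_bound_inner (x y : MeanSpace Ψ H) : ∃ C, ∀ g, ‖inner ℂ (x g) (y g)‖ ≤ C := by
  obtain ⟨C, hC⟩ := x.exists_bound
  obtain ⟨D, hD⟩ := y.exists_bound
  exact ⟨C * D, fun g => (norm_inner_le_norm _ _).trans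
    (mul_le_mul (hC g) (hD g) (norm_nonneg _) ((norm_nonneg _).trans (hC g)))⟩

/-- The ultralimit of the averages of the pointwise inner products. -/
noncomputable def meanInner (x y : MeanSpace Ψ H) : ℂ :=
  ultraLim fun n => ∫ g, inner ℂ (x g) (y g) ∂(Ψ n : Measure G)

theorem tendsto_meanInner (x y : MeanSpace Ψ H) :
    Tendsto (fun n => ∫ g, inner ℂ (x g) (y g) ∂(Ψ n : Measure G)) (hyperfilter ℕ : Filter ℕ)
      (𝓝 (meanInner x y)) := by
  obtain ⟨C, hC⟩ := exists_bound_inner x y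
  exact tendsto_ultraLim fun n => norm_integral_le_of_bounded hC (Ψ n : Measure G)

variable [SigmaCompactSpace G] [BorelSpace G]

theorem integrable_inner (x y : MeanSpace Ψ H) (F : Measure G) [IsFiniteMeasure F] :
    Integrable (fun g => inner ℂ (x g) (y g)) F := by
  obtain ⟨C, hC⟩ := exists_bound_inner x y
  exact integrable_of_continuous_of_bounded (continuous_inner x y) hC F

variable (Ψ H) in
/-- The semi-inner product space structure on `MeanSpace Ψ H`. -/
@[reducible] noncomputable def core : PreInnerProductSpace.Core ℂ (MeanSpace Ψ H) where
  inner := meanInner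
  conj_inner_symm x y := by
    have h := (Complex.continuous_conj.tendsto _).comp (tendsto_meanInner y x)
    refine tendsto_nhds_unique h ((tendsto_meanInner x y).congr fun n => ?_)
    rw [Function.comp_apply, ← integral_conj]
    simp only [inner_conj_symm]
  re_inner_nonneg x := by
    have h := (Complex.continuous_re.tendsto _).comp (tendsto_meanInner x x)
    refine ge_of_tendsto h (Eventually.of_forall fun n => ?_)
    have := (Complex.reCLM.integral_comp_comm (integrable_inner x x (Ψ n : Measure G)))
    simp only [Function.comp_apply]
    rw [← Complex.reCLM_apply, ← this]
    exact integral_nonneg fun g => inner_self_nonneg (𝕜 := ℂ)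
  add_left x y z := by
    refine tendsto_nhds_unique (tendsto_meanInner (x + y) z)
      (((tendsto_meanInner x z).add (tendsto_meanInner y z)).congr fun n => ?_)
    rw [← integral_add (integrable_inner x z _) (integrable_inner y z _)]
    simp only [add_apply, inner_add_left]
  smul_left x y r := by
    refine tendsto_nhds_unique (tendsto_meanInner (r • x) y)
      (((tendsto_meanInner x y).const_mul _).congr fun n => ?_)
    rw [← integral_const_mul]
    simp only [smul_apply, inner_smul_left]

noncomputable instance : SeminormedAddCommGroup (MeanSpace Ψ H) :=
  InnerProductSpace.Core.toSeminormedAddCommGroup (c := core Ψ H)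

noncomputable instance : InnerProductSpace ℂ (MeanSpace Ψ H) := InnerProductSpace.ofCore (core Ψ H)

theorem inner_eq_of_tendsto {x y : MeanSpace Ψ H} {z : ℂ}
    (h : Tendsto (fun n => ∫ g, inner ℂ (x g) (y g) ∂(Ψ n : Measure G)) atTop (𝓝 z)) :
    inner ℂ x y = z :=
  ultraLim_eq_of_tendsto h

theorem norm_le_of_forall_le {x : MeanSpace Ψ H} {C : ℝ} (hC0 : 0 ≤ C) (hC : ∀ g, ‖x g‖ ≤ C) :
    ‖x‖ ≤ C := by
  have h : ‖inner ℂ x x‖ ≤ C * C := by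
    refine le_of_tendsto (tendsto_meanInner x x).norm (Eventually.of_forall fun n => ?_)
    exact norm_integral_le_of_bounded (fun g => (norm_inner_le_norm _ _).trans
      (mul_le_mul (hC g) (hC g) (norm_nonneg _) hC0)) (Ψ n : Measure G)
  rw [inner_self_eq_norm_sq_to_K, norm_pow, RCLike.norm_ofReal, abs_norm] at h
  nlinarith [norm_nonneg x]

/-- A linear isometry of `H`, applied pointwise. -/
noncomputable def postcomp (u : H →ₗᵢ[ℂ] H) : MeanSpace Ψ H →ₗᵢ[ℂ] MeanSpace Ψ H :=
  LinearMap.isometryOfInner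
    { toFun := fun x => mk (fun g => u (x g)) (u.continuous.comp x.continuous)
        (by simpa only [u.norm_map] using x.exists_bound)
      map_add' := fun x y => ext fun g => by simp
      map_smul' := fun c x => ext fun g => by simp }
    fun x y => by
      change ultraLim _ = ultraLim _
      simp

@[simp] theorem postcomp_apply (u : H →ₗᵢ[ℂ] H) (x : MeanSpace Ψ H) (g : G) :
    postcomp u x g = u (x g) := rfl

end MeanSpace

end MeanSpace

section Completion

open UniformSpace

variable {F : Type*} [SeminormedAddCommGroup F] [InnerProductSpace ℂ F]

/-- The extension of a linear isometry to the completion. -/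
noncomputable def LinearIsometry.toCompletion (u : F →ₗᵢ[ℂ] F) :
    Completion F →ₗᵢ[ℂ] Completion F where
  toLinearMap := ((Completion.toComplL ∘L u.toContinuousLinearMap).extend
    (Completion.toComplL : F →L[ℂ] Completion F)).toLinearMap
  norm_map' := by
    have h := fun x : F => ContinuousLinearMap.extend_eq
      (f := (Completion.toComplL : F →L[ℂ] Completion F) ∘L u.toContinuousLinearMap)
      (e := (Completion.toComplL : F →L[ℂ] Completion F)) Completion.denseRange_coe
      (Completion.isUniformInducing_coe _) x
    intro x
    induction x using Completion.induction_on with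
    | hp => exact isClosed_eq (by simp only [ContinuousLinearMap.coe_coe]; fun_prop)
              continuous_norm
    | ih x =>
      have := h x
      simp only [Completion.coe_toComplL] at this
      simp only [ContinuousLinearMap.coe_coe]
      rw [this]
      simp

@[simp] theorem LinearIsometry.toCompletion_coe (u : F →ₗᵢ[ℂ] F) (x : F) :
    u.toCompletion (x : Completion F) = (u x : Completion F) :=
  ContinuousLinearMap.extend_eq
    (f := (Completion.toComplL : F →L[ℂ] Completion F) ∘L u.toContinuousLinearMap)
    (e := (Completion.toComplL : F →L[ℂ] Completion F)) Completion.denseRange_coe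
    (Completion.isUniformInducing_coe _) x

end Completion

/-! ### Commuting unitary representations normalizing a commutative algebra -/

section CubicSystem

open ContinuousLinearMap (adjoint)

variable {H : Type*} [NormedAddCommGroup H] [InnerProductSpace ℂ H]

/-- The conjugate `u a u⁻¹` of an operator by a unitary. -/
noncomputable def conjOp (u : H ≃ₗᵢ[ℂ] H) (a : H →L[ℂ] H) : H →L[ℂ] H :=
  u.toLinearIsometry.toContinuousLinearMap ∘L a ∘L u.symm.toLinearIsometry.toContinuousLinearMap

@[simp] theorem conjOp_apply (u : H ≃ₗᵢ[ℂ] H) (a : H →L[ℂ] H) (v : H) :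
    conjOp u a v = u (a (u.symm v)) := rfl

theorem map_eq_conjOp (u : H ≃ₗᵢ[ℂ] H) (a : H →L[ℂ] H) (v : H) :
    u (a v) = conjOp u a (u v) := by simp

theorem norm_conjOp_le (u : H ≃ₗᵢ[ℂ] H) (a : H →L[ℂ] H) : ‖conjOp u a‖ ≤ ‖a‖ :=
  ContinuousLinearMap.opNorm_le_bound _ (norm_nonneg _) fun v => by
    rw [conjOp_apply, u.norm_map, ← u.symm.norm_map v]
    exact a.le_opNorm _

theorem norm_conjOp_apply_le (u : H ≃ₗᵢ[ℂ] H) (a : H →L[ℂ] H) (v : H) :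
    ‖conjOp u a v‖ ≤ ‖a‖ * ‖v‖ :=
  (conjOp u a).le_of_opNorm_le (norm_conjOp_le u a) v

theorem conjOp_comp (u : H ≃ₗᵢ[ℂ] H) (a b : H →L[ℂ] H) :
    conjOp u (a ∘L b) = conjOp u a ∘L conjOp u b := by
  ext v
  simp

theorem adjoint_conjOp [CompleteSpace H] (u : H ≃ₗᵢ[ℂ] H) (a : H →L[ℂ] H) :
    adjoint (conjOp u a) = conjOp u (adjoint a) := by
  refine ((ContinuousLinearMap.eq_adjoint_iff _ _).2 fun x y => ?_).symm
  rw [conjOp_apply, conjOp_apply, u.inner_map_eq_flip, ContinuousLinearMap.adjoint_inner_left,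
    u.symm.inner_map_eq_flip, LinearIsometryEquiv.symm_symm]

/-- The operator-theoretic shadow of a pair of commuting actions: two commuting, strongly
continuous unitary (anti-)representations `U₁, U₂` on a Hilbert space, and a commutative
self-adjoint semigroup `alg` of bounded operators (the multiplication operators) which both of them
normalize, with a cyclic vector `vac` (the constant function `1`) fixed by both. -/
structure CubicSystem (G H : Type*) [Group G] [TopologicalSpace G] [NormedAddCommGroup H]
    [InnerProductSpace ℂ H] [CompleteSpace H] where
  /-- the first representation -/
  U₁ : G → H ≃ₗᵢ[ℂ] H
  /-- the second representation -/
  U₂ : G → H ≃ₗᵢ[ℂ] H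
  mul₁ : ∀ g h v, U₁ (g * h) v = U₁ h (U₁ g v)
  mul₂ : ∀ g h v, U₂ (g * h) v = U₂ h (U₂ g v)
  continuous₁ : ∀ v, Continuous fun g => U₁ g v
  continuous₂ : ∀ v, Continuous fun g => U₂ g v
  comm : ∀ g h v, U₁ g (U₂ h v) = U₂ h (U₁ g v)
  /-- the multiplication operators -/
  alg : Set (H →L[ℂ] H)
  mul_mem : ∀ {a b}, a ∈ alg → b ∈ alg → a ∘L b ∈ alg
  adjoint_mem : ∀ {a}, a ∈ alg → adjoint a ∈ alg
  commute : ∀ {a b}, a ∈ alg → b ∈ alg → ∀ v, a (b v) = b (a v)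
  conj₁_mem : ∀ {a}, a ∈ alg → ∀ g, conjOp (U₁ g) a ∈ alg
  conj₂_mem : ∀ {a}, a ∈ alg → ∀ g, conjOp (U₂ g) a ∈ alg
  /-- the cyclic vector -/
  vac : H
  vac₁ : ∀ g, U₁ g vac = vac
  vac₂ : ∀ g, U₂ g vac = vac
  dense : Dense {v | ∃ a ∈ alg, a vac = v}

end CubicSystem

section Representation

variable {G : Type*} {H : Type*} [NormedAddCommGroup H] [InnerProductSpace ℂ H]

theorem continuous_unitary_apply [TopologicalSpace G] {U : G → H ≃ₗᵢ[ℂ] H}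
    (hU : ∀ v, Continuous fun g => U g v) {Y : Type*} [TopologicalSpace Y] {k : Y → G}
    {x : Y → H} (hk : Continuous k) (hx : Continuous x) : Continuous fun y => U (k y) (x y) := by
  have h : Continuous fun p : G × H => U p.1 p.2 :=
    continuous_prod_of_continuous_lipschitzWith' _ 1 (fun g => (U g).lipschitz) hU
  exact h.comp (hk.prodMk hx)

theorem unitary_symm_apply [Group G] {U : G → H ≃ₗᵢ[ℂ] H} (hU : ∀ g h v, U (g * h) v = U h (U g v))
    (g : G) (v : H) : (U g).symm v = U g⁻¹ v := by
  have h1 : ∀ v, U 1 v = v := fun v => (U 1).injective (by rw [← hU, one_mul])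
  rw [LinearIsometryEquiv.symm_apply_eq, ← hU, inv_mul_cancel, h1]

/-- The closed subspace of vectors fixed by a family of unitaries. -/
noncomputable def fixedSubspace (U : G → H ≃ₗᵢ[ℂ] H) : Submodule ℂ H where
  carrier := {v | ∀ g, U g v = v}
  add_mem' hx hy g := by rw [map_add, hx g, hy g]
  zero_mem' g := map_zero _
  smul_mem' c x hx g := by rw [map_smul, hx g]

theorem mem_fixedSubspace {U : G → H ≃ₗᵢ[ℂ] H} {v : H} :
    v ∈ fixedSubspace U ↔ ∀ g, U g v = v := Iff.rfl

theorem isClosed_fixedSubspace (U : G → H ≃ₗᵢ[ℂ] H) : IsClosed (fixedSubspace U : Set H) := by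
  have : (fixedSubspace U : Set H) = ⋂ g, {v | U g v = v} := by
    ext v
    simp [mem_fixedSubspace]
  rw [this]
  exact isClosed_iInter fun g => isClosed_eq (U g).continuous continuous_id

instance [CompleteSpace H] (U : G → H ≃ₗᵢ[ℂ] H) : (fixedSubspace U).HasOrthogonalProjection :=
  have : CompleteSpace (fixedSubspace U) := (isClosed_fixedSubspace U).completeSpace_coe
  inferInstance

variable [Group G] [TopologicalSpace G] [IsTopologicalGroup G]

theorem continuous_conjOp_apply {U : G → H ≃ₗᵢ[ℂ] H} (hU : ∀ g h v, U (g * h) v = U h (U g v))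
    (hUc : ∀ v, Continuous fun g => U g v) (a : H →L[ℂ] H)
    {Y : Type*} [TopologicalSpace Y] {k : Y → G} {x : Y → H} (hk : Continuous k)
    (hx : Continuous x) : Continuous fun y => conjOp (U (k y)) a (x y) := by
  simp only [conjOp_apply, unitary_symm_apply hU]
  exact continuous_unitary_apply hUc hk
    (a.continuous.comp (continuous_unitary_apply hUc hk.inv hx))

variable [CompleteSpace H] [T2Space G] [SigmaCompactSpace G] [MeasurableSpace G] [BorelSpace G]

theorem tendsto_integral_unitary {U : G → H ≃ₗᵢ[ℂ] H} (hU : ∀ g h v, U (g * h) v = U h (U g v))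
    (hUc : ∀ v, Continuous fun g => U g v) {E : Type*} [NormedAddCommGroup E] [NormedSpace ℂ E]
    [CompleteSpace E] (L : H →L[ℂ] E) (v : H) {Φ : ℕ → ProbabilityMeasure G}
    (hΦ : IsLeftReiter Φ) :
    Tendsto (fun n => ∫ g, L (U g v) ∂(Φ n : Measure G)) atTop
      (𝓝 (L ((fixedSubspace U).starProjection v))) := by
  obtain ⟨m, hm, hmv⟩ := exists_fixed_of_isometries (fun g => (U g).toLinearIsometry) hU v
  have hmE : (fixedSubspace U).starProjection v = m := by
    refine Submodule.eq_starProjection_of_mem_of_inner_eq_zero hm fun w hw => ?_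
    have := inner_eq_of_mem_closure_averages (V := fun g => (U g).toLinearIsometry) hw hmv
    rw [← inner_conj_symm, inner_sub_right, this, sub_self, map_zero]
  rw [hmE]
  exact tendsto_integral_of_fixed hU hm hmv L (L.continuous.comp (hUc v)) hΦ

end Representation

/-! ### The lifted representation and the duality pairing -/

namespace CubicSystem

open ContinuousLinearMap (adjoint)

variable {G : Type*} [Group G] [TopologicalSpace G]
  {H : Type*} [NormedAddCommGroup H] [InnerProductSpace ℂ H] [CompleteSpace H]
  (S : CubicSystem G H)

/-- The projection to the vectors fixed by the second representation. -/
noncomputable def proj : H →L[ℂ] H := (fixedSubspace S.U₂).starProjection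

theorem U₂_proj (g : G) (v : H) : S.U₂ g (S.proj v) = S.proj v :=
  Submodule.starProjection_apply_mem (fixedSubspace S.U₂) v g

theorem inner_proj_left (v w : H) : inner ℂ (S.proj v) w = inner ℂ v (S.proj w) :=
  (fixedSubspace S.U₂).inner_starProjection_left_eq_right v w

theorem inner_vac_translate {a b c d : H →L[ℂ] H} (ha : a ∈ S.alg) (hb : b ∈ S.alg)
    (hc : c ∈ S.alg) (g : G) :
    inner ℂ (a (S.U₂ g (c S.vac))) (b (S.U₂ g (d S.vac))) =
      inner ℂ (adjoint b (a S.vac)) (S.U₂ g (adjoint c (d S.vac))) := by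
  have hcg := S.conj₂_mem hc g
  rw [map_eq_conjOp (S.U₂ g) c, map_eq_conjOp (S.U₂ g) (adjoint c), ← adjoint_conjOp,
    ContinuousLinearMap.adjoint_inner_right, ← ContinuousLinearMap.adjoint_inner_left, S.vac₂,
    S.commute ha hcg, S.commute (S.adjoint_mem hb) hcg]

theorem continuous_U₂_apply (a : H →L[ℂ] H) (v : H) :
    Continuous fun p : G × G => a (S.U₂ p.2 v) :=
  a.continuous.comp ((S.continuous₂ v).comp continuous_snd)

/-- The trilinear expression `(U₁ g₁ f₁ U₁ g₁⁻¹) (U₂ g₂ f₂ U₂ g₂⁻¹) U₂ g₂ U₁ g₁ v` as an operator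
in the last argument; in the concrete system it is `T₁^{g₁}f₁ · T₂^{g₂}f₂ · T₁^{g₁}T₂^{g₂}v`. -/
noncomputable def form (f₁ f₂ : H →L[ℂ] H) (g₁ g₂ : G) : H →L[ℂ] H :=
  conjOp (S.U₁ g₁) f₁ ∘L conjOp (S.U₂ g₂) f₂ ∘L
    (S.U₂ g₂).toLinearIsometry.toContinuousLinearMap ∘L
    (S.U₁ g₁).toLinearIsometry.toContinuousLinearMap

theorem form_apply (f₁ f₂ : H →L[ℂ] H) (g₁ g₂ : G) (v : H) : S.form f₁ f₂ g₁ g₂ v =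
    conjOp (S.U₁ g₁) f₁ (conjOp (S.U₂ g₂) f₂ (S.U₂ g₂ (S.U₁ g₁ v))) := rfl

theorem form_apply_eq_conjOp {f₁ f₂ : H →L[ℂ] H} (h₁ : f₁ ∈ S.alg) (h₂ : f₂ ∈ S.alg) (g₁ g₂ : G)
    (v : H) : S.form f₁ f₂ g₁ g₂ v = conjOp (S.U₂ g₂) f₂ (S.U₁ g₁ (f₁ (S.U₂ g₂ v))) := by
  rw [form_apply, S.commute (S.conj₁_mem h₁ g₁) (S.conj₂_mem h₂ g₂), ← S.comm, ← map_eq_conjOp]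

theorem norm_form_le (f₁ f₂ : H →L[ℂ] H) (g₁ g₂ : G) :
    ‖S.form f₁ f₂ g₁ g₂‖ ≤ ‖f₁‖ * ‖f₂‖ :=
  ContinuousLinearMap.opNorm_le_bound _ (by positivity) fun v => by
    rw [form_apply, mul_assoc]
    refine (norm_conjOp_apply_le _ _ _).trans (mul_le_mul_of_nonneg_left ?_ (norm_nonneg _))
    refine (norm_conjOp_apply_le _ _ _).trans_eq ?_
    rw [LinearIsometryEquiv.norm_map, LinearIsometryEquiv.norm_map]

theorem continuous_form_apply [IsTopologicalGroup G] (f₁ f₂ : H →L[ℂ] H) (v : H) :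
    Continuous fun p : G × G => S.form f₁ f₂ p.1 p.2 v := by
  simp only [form_apply]
  refine continuous_conjOp_apply S.mul₁ S.continuous₁ f₁ continuous_fst ?_
  refine continuous_conjOp_apply S.mul₂ S.continuous₂ f₂ continuous_snd ?_
  exact continuous_unitary_apply S.continuous₂ continuous_snd
    ((S.continuous₁ v).comp continuous_fst)

variable [MeasurableSpace G] (Ψ : ℕ → ProbabilityMeasure G) [SigmaCompactSpace G] [BorelSpace G]

/-- The function `g ↦ a (U₂ g v)`, as a vector in the Hilbert space of functions on the group. -/
noncomputable def lift (a : H →L[ℂ] H) : H →L[ℂ] UniformSpace.Completion (MeanSpace Ψ H) :=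
  UniformSpace.Completion.toComplL ∘L LinearMap.mkContinuous
    { toFun := fun v => MeanSpace.mk (fun g => a (S.U₂ g v)) (a.continuous.comp (S.continuous₂ v))
        ⟨‖a‖ * ‖v‖, fun g => a.le_opNorm_of_le ((S.U₂ g).norm_map v).le⟩
      map_add' := fun v w => MeanSpace.ext fun g => by simp
      map_smul' := fun c v => MeanSpace.ext fun g => by simp } ‖a‖
    fun v => MeanSpace.norm_le_of_forall_le (by positivity)
      fun g => a.le_opNorm_of_le ((S.U₂ g).norm_map v).le

theorem lift_apply (a : H →L[ℂ] H) (v : H) : S.lift Ψ a v =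
    ((MeanSpace.mk (fun g => a (S.U₂ g v)) (a.continuous.comp (S.continuous₂ v))
      ⟨‖a‖ * ‖v‖, fun g => a.le_opNorm_of_le ((S.U₂ g).norm_map v).le⟩ : MeanSpace Ψ H) :
      UniformSpace.Completion (MeanSpace Ψ H)) := rfl

theorem norm_lift_le (a : H →L[ℂ] H) : ‖S.lift Ψ a‖ ≤ ‖a‖ := by
  refine ContinuousLinearMap.opNorm_le_bound _ (norm_nonneg _) fun v => ?_
  rw [lift_apply, UniformSpace.Completion.norm_coe]
  exact MeanSpace.norm_le_of_forall_le (by positivity)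
    fun g => a.le_opNorm_of_le ((S.U₂ g).norm_map v).le

/-- The first representation, acting pointwise on functions. -/
noncomputable def rep (g : G) :
    UniformSpace.Completion (MeanSpace Ψ H) →ₗᵢ[ℂ] UniformSpace.Completion (MeanSpace Ψ H) :=
  (MeanSpace.postcomp (S.U₁ g).toLinearIsometry).toCompletion

theorem rep_mul (g h : G) (ξ : UniformSpace.Completion (MeanSpace Ψ H)) :
    S.rep Ψ (g * h) ξ = S.rep Ψ h (S.rep Ψ g ξ) := by
  induction ξ using UniformSpace.Completion.induction_on with
  | hp => exact isClosed_eq (LinearIsometry.continuous _)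
            ((LinearIsometry.continuous _).comp (LinearIsometry.continuous _))
  | ih x =>
    simp only [rep, LinearIsometry.toCompletion_coe]
    congr 1
    exact MeanSpace.ext fun k => S.mul₁ g h (x k)

theorem rep_lift (g : G) (a : H →L[ℂ] H) (v : H) :
    S.rep Ψ g (S.lift Ψ a v) = S.lift Ψ (conjOp (S.U₁ g) a) (S.U₁ g v) := by
  simp only [rep, lift_apply, LinearIsometry.toCompletion_coe]
  congr 1
  refine MeanSpace.ext fun k => ?_
  simp [← S.comm]

theorem inner_lift_eq_of_tendsto (a b : H →L[ℂ] H) (v w : H) {z : ℂ}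
    (h : Tendsto (fun n => ∫ g, inner ℂ (a (S.U₂ g v)) (b (S.U₂ g w)) ∂(Ψ n : Measure G)) atTop
      (𝓝 z)) : inner ℂ (S.lift Ψ a v) (S.lift Ψ b w) = z := by
  rw [lift_apply, lift_apply, UniformSpace.Completion.inner_coe]
  exact MeanSpace.inner_eq_of_tendsto h

/-- The closed span of the lifts of bounded vectors by multiplication operators: the operator form
of `L²` of the relatively independent self-joining over the factor of `U₂`-fixed functions. -/
noncomputable def liftSpan : Submodule ℂ (UniformSpace.Completion (MeanSpace Ψ H)) :=
  (Submodule.span ℂ {ξ | ∃ a ∈ S.alg, ∃ c ∈ S.alg, S.lift Ψ a (c S.vac) = ξ}).topologicalClosure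

theorem lift_mem_liftSpan {Ψ : ℕ → ProbabilityMeasure G} {a : H →L[ℂ] H} (ha : a ∈ S.alg) (v : H) :
    S.lift Ψ a v ∈ S.liftSpan Ψ := by
  refine map_mem_closure (S.lift Ψ a).continuous (S.dense v) ?_
  rintro _ ⟨c, hc, rfl⟩
  exact Submodule.subset_span ⟨a, ha, c, hc, rfl⟩

theorem U₁_adjoint_lift {Ψ : ℕ → ProbabilityMeasure G} (b : H →L[ℂ] H)
    {η : UniformSpace.Completion (MeanSpace Ψ H)}
    (hη : ∀ g, S.rep Ψ g η = η) (g : G) :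
    S.U₁ g (adjoint (S.lift Ψ b) η) = adjoint (S.lift Ψ (conjOp (S.U₁ g) b)) η := by
  refine ext_inner_right ℂ fun w => ?_
  obtain ⟨w, rfl⟩ := (S.U₁ g).surjective w
  rw [LinearIsometryEquiv.inner_map_map, ContinuousLinearMap.adjoint_inner_left,
    ContinuousLinearMap.adjoint_inner_left, ← S.rep_lift]
  conv_rhs => rw [← hη g]
  exact ((S.rep Ψ g).inner_map_map _ _).symm

variable [IsTopologicalGroup G] [T2Space G]

theorem tendsto_integral_inner_vac {a b c d : H →L[ℂ] H} (ha : a ∈ S.alg) (hb : b ∈ S.alg)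
    (hc : c ∈ S.alg) {Ψ' : ℕ → ProbabilityMeasure G} (hΨ' : IsLeftReiter Ψ') :
    Tendsto (fun n => ∫ g, inner ℂ (a (S.U₂ g (c S.vac))) (b (S.U₂ g (d S.vac)))
      ∂(Ψ' n : Measure G)) atTop
      (𝓝 (inner ℂ (adjoint b (a S.vac)) (S.proj (adjoint c (d S.vac))))) := by
  simp only [S.inner_vac_translate ha hb hc]
  exact tendsto_integral_unitary S.mul₂ S.continuous₂
    (innerSL ℂ (adjoint b (a S.vac))) (adjoint c (d S.vac)) hΨ'

variable {Ψ}

/-- The composition of a lift with the adjoint of another one is given by the projection to the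
fixed vectors: the relatively independent self-joining over the fixed factor, in operator form. -/
theorem adjoint_lift_lift_vac (hΨ : IsLeftReiter Ψ) {a b c : H →L[ℂ] H} (ha : a ∈ S.alg)
    (hb : b ∈ S.alg) (hc : c ∈ S.alg) :
    adjoint (S.lift Ψ b) (S.lift Ψ a (c S.vac)) = c (S.proj (adjoint b (a S.vac))) := by
  refine S.dense.eq_of_inner_right (𝕜 := ℂ) ?_
  rintro _ ⟨d, hd, rfl⟩
  rw [ContinuousLinearMap.adjoint_inner_right, ← inner_conj_symm,
    S.inner_lift_eq_of_tendsto Ψ a b _ _ (S.tendsto_integral_inner_vac ha hb hc hΨ),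
    inner_conj_symm, inner_proj_left, ContinuousLinearMap.adjoint_inner_left]

end CubicSystem

/-! ### Correlations along Reiter sequences -/

theorem norm_sq_sum_smul {ι E : Type*} [NormedAddCommGroup E] [InnerProductSpace ℂ E]
    (s : Finset ι) (σ : ι → ℝ) (x : ι → E) : ‖∑ h ∈ s, σ h • x h‖ ^ 2 =
      ∑ h ∈ s, ∑ k ∈ s, σ h * σ k * (inner ℂ (x h) (x k)).re := by
  rw [← inner_self_eq_norm_sq (𝕜 := ℂ), sum_inner]
  simp only [inner_sum, ← Complex.coe_smul, inner_smul_left, inner_smul_right,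
    Complex.conj_ofReal, RCLike.re_to_complex, Complex.re_sum, Complex.re_ofReal_mul]
  exact Finset.sum_congr rfl fun h _ => Finset.sum_congr rfl fun k _ => by ring

namespace CubicSystem

open ContinuousLinearMap (adjoint)

variable {G : Type*} [Group G] [TopologicalSpace G] [IsTopologicalGroup G] [T2Space G]
  [SigmaCompactSpace G] [MeasurableSpace G] [BorelSpace G]
  {H : Type*} [NormedAddCommGroup H] [InnerProductSpace ℂ H] [CompleteSpace H]
  (S : CubicSystem G H)

theorem hasReiterLimit_inner {a b : H →L[ℂ] H} (ha : a ∈ S.alg) (hb : b ∈ S.alg) (v w : H) :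
    HasReiterLimit fun _ g : G => inner ℂ (a (S.U₂ g v)) (b (S.U₂ g w)) := by
  have hbd : ∀ (a : H →L[ℂ] H) (v : H) (g : G), ‖a (S.U₂ g v)‖ ≤ ‖a‖ * ‖v‖ := fun a v g =>
    a.le_opNorm_of_le ((S.U₂ g).norm_map v).le
  -- density of the vectors `d vac` in the second argument, for a first argument `c vac`
  have key : ∀ {a b : H →L[ℂ] H}, a ∈ S.alg → b ∈ S.alg → ∀ c ∈ S.alg, ∀ w : H,
      HasReiterLimit fun _ g : G => inner ℂ (a (S.U₂ g (c S.vac))) (b (S.U₂ g w)) := by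
    intro a b ha hb c hc w
    let Λ : G → G → H →L[ℂ] ℂ := fun _ g => innerSL ℂ (a (S.U₂ g (c S.vac))) ∘L b ∘L
      (S.U₂ g).toLinearIsometry.toContinuousLinearMap
    have hΛ : ∀ g₁ g₂, ‖Λ g₁ g₂‖ ≤ ‖a‖ * ‖c S.vac‖ * ‖b‖ := fun g₁ g₂ =>
      ContinuousLinearMap.opNorm_le_bound _ (by positivity) fun x => by
        rw [mul_assoc]
        exact (norm_inner_le_norm _ _).trans (mul_le_mul (hbd _ _ _) (hbd _ _ _)
          (norm_nonneg _) (by positivity))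
    have hmem : ∀ x ∈ {v | ∃ d ∈ S.alg, d S.vac = v}, x ∈ HasReiterLimit.submodule Λ := by
      rintro _ ⟨d, -, rfl⟩
      refine HasReiterLimit.of_tendsto
        ((S.continuous_U₂_apply a _).inner (S.continuous_U₂_apply b _))
        (fun g₁ g₂ => (Λ g₁ g₂).le_of_opNorm_le (hΛ g₁ g₂) (d S.vac))
        (inner ℂ (adjoint b (a S.vac)) (S.proj (adjoint c (d S.vac)))) fun Φ Ψ _ hΨ => ?_
      refine (S.tendsto_integral_inner_vac ha hb hc hΨ (d := d)).congr fun n => ?_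
      simp [doubleAverage, Λ]
    exact (HasReiterLimit.isClosed_submodule hΛ).closure_subset_iff.2 hmem (S.dense w)
  let Λ : G → G → H →L[ℂ] ℂ := fun _ g => innerSL ℂ (b (S.U₂ g w)) ∘L a ∘L
      (S.U₂ g).toLinearIsometry.toContinuousLinearMap
  have hΛ : ∀ g₁ g₂, ‖Λ g₁ g₂‖ ≤ ‖b‖ * ‖w‖ * ‖a‖ := fun g₁ g₂ =>
    ContinuousLinearMap.opNorm_le_bound _ (by positivity) fun x => by
      rw [mul_assoc]
      exact (norm_inner_le_norm _ _).trans (mul_le_mul (hbd _ _ _) (hbd _ _ _)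
        (norm_nonneg _) (by positivity))
  have hmem : ∀ x ∈ {v | ∃ d ∈ S.alg, d S.vac = v}, x ∈ HasReiterLimit.submodule Λ := by
    rintro _ ⟨c, hc, rfl⟩
    have h := (key ha hb c hc w).clm_comp Complex.conjCLE.toContinuousLinearMap
    have : (fun g₁ g₂ => Λ g₁ g₂ (c S.vac)) = fun _ g =>
        Complex.conjCLE.toContinuousLinearMap (inner ℂ (a (S.U₂ g (c S.vac))) (b (S.U₂ g w))) := by
      simp [Λ]
    change HasReiterLimit fun g₁ g₂ => Λ g₁ g₂ (c S.vac)
    rwa [this]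
  have h : HasReiterLimit fun g₁ g₂ => Λ g₁ g₂ v :=
    (HasReiterLimit.isClosed_submodule hΛ).closure_subset_iff.2 hmem (S.dense v)
  simpa [Λ] using h.clm_comp Complex.conjCLE.toContinuousLinearMap

/-- The semi-inner product defined by an ultralimit along one Reiter sequence is, on lifts, the
genuine limit of the averages along every Reiter sequence. -/
theorem tendsto_integral_inner {Ψ : ℕ → ProbabilityMeasure G} (hΨ : IsLeftReiter Ψ)
    {a b : H →L[ℂ] H} (ha : a ∈ S.alg) (hb : b ∈ S.alg) (v w : H)
    {Ψ' : ℕ → ProbabilityMeasure G} (hΨ' : IsLeftReiter Ψ') :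
    Tendsto (fun n => ∫ g, inner ℂ (a (S.U₂ g v)) (b (S.U₂ g w)) ∂(Ψ' n : Measure G)) atTop
      (𝓝 (inner ℂ (S.lift Ψ a v) (S.lift Ψ b w))) := by
  obtain ⟨z, hz⟩ := (S.hasReiterLimit_inner ha hb v w).exists_tendsto hΨ
  have hz' : ∀ Ψ'' : ℕ → ProbabilityMeasure G, IsLeftReiter Ψ'' →
      Tendsto (fun n => ∫ g, inner ℂ (a (S.U₂ g v)) (b (S.U₂ g w)) ∂(Ψ'' n : Measure G)) atTop
      (𝓝 z) := fun Ψ'' h => by simpa [doubleAverage] using hz Ψ'' Ψ'' h h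
  rw [S.inner_lift_eq_of_tendsto Ψ a b v w (hz' Ψ hΨ)]
  exact hz' Ψ' hΨ'

theorem tendsto_integral_norm_sq_sum {Ψ : ℕ → ProbabilityMeasure G} (hΨ : IsLeftReiter Ψ)
    (s : Finset G) (σ : G → ℝ) {a : G → H →L[ℂ] H} (ha : ∀ h, a h ∈ S.alg) (v : G → H)
    {Ψ' : ℕ → ProbabilityMeasure G} (hΨ' : IsLeftReiter Ψ') :
    Tendsto (fun n => ∫ g, ‖∑ h ∈ s, σ h • a h (S.U₂ g (v h))‖ ^ 2 ∂(Ψ' n : Measure G)) atTop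
      (𝓝 (‖∑ h ∈ s, σ h • S.lift Ψ (a h) (v h)‖ ^ 2)) := by
  rw [norm_sq_sum_smul]
  have hint : ∀ h k (n : ℕ), Integrable
      (fun g => inner ℂ (a h (S.U₂ g (v h))) (a k (S.U₂ g (v k)))) (Ψ' n : Measure G) := by
    intro h k n
    obtain ⟨C, hC⟩ := (S.hasReiterLimit_inner (ha h) (ha k) (v h) (v k)).bounded
    exact integrable_of_continuous_of_bounded
      (((a h).continuous.comp (S.continuous₂ _)).inner ((a k).continuous.comp (S.continuous₂ _)))
      (fun g => hC 1 g) _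
  have hre : ∀ h k (n : ℕ), ∫ g, (inner ℂ (a h (S.U₂ g (v h))) (a k (S.U₂ g (v k)))).re
      ∂(Ψ' n : Measure G) = (∫ g, inner ℂ (a h (S.U₂ g (v h))) (a k (S.U₂ g (v k)))
      ∂(Ψ' n : Measure G)).re := fun h k n => Complex.reCLM.integral_comp_comm (hint h k n)
  have hlim := tendsto_finsetSum s fun h _ => tendsto_finsetSum s fun k _ =>
    ((Complex.continuous_re.tendsto _).comp
      (S.tendsto_integral_inner hΨ (ha h) (ha k) (v h) (v k) hΨ')).const_mul (σ h * σ k)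
  refine hlim.congr fun n => ?_
  simp only [norm_sq_sum_smul, Function.comp_apply]
  have hI : ∀ h k, Integrable (fun g => σ h * σ k *
      (inner ℂ (a h (S.U₂ g (v h))) (a k (S.U₂ g (v k)))).re) (Ψ' n : Measure G) :=
    fun h k => (hint h k n).re.const_mul _
  rw [integral_finsetSum s fun h _ => integrable_finsetSum s fun k _ => hI h k]
  refine Finset.sum_congr rfl fun h _ => ?_
  rw [integral_finsetSum s fun k _ => hI h k]
  refine Finset.sum_congr rfl fun k _ => ?_
  rw [integral_const_mul, hre]

/-! ### Structured vectors -/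

/-- Averages of products in which the two group variables have been separated. -/
theorem hasReiterLimit_conjOp_of_tendsto {e : H →L[ℂ] H} (he : e ∈ S.alg) {q : G → H}
    (hq : Continuous q) {C : ℝ} (hC : ∀ g, ‖q g‖ ≤ C) {Q : H}
    (hQ : ∀ Φ : ℕ → ProbabilityMeasure G, IsLeftReiter Φ →
      Tendsto (fun n => ∫ g, q g ∂(Φ n : Measure G)) atTop (𝓝 Q)) :
    HasReiterLimit fun g₁ g₂ => conjOp (S.U₂ g₂) e (q g₁) where
  continuous := continuous_conjOp_apply S.mul₂ S.continuous₂ e continuous_snd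
    (hq.comp continuous_fst)
  bounded := ⟨‖e‖ * C, fun g₁ g₂ => (norm_conjOp_apply_le _ _ _).trans
    (mul_le_mul_of_nonneg_left (hC g₁) (norm_nonneg _))⟩
  eventually_near ε hε := by
    set δ := ε / (3 * (‖e‖ + 1)) with hδ
    have hδ0 : 0 < δ := by positivity
    -- a bounded approximation `d vac` of `Q`, for which the products can be commuted
    obtain ⟨_, hdQ, ⟨d, hd, rfl⟩⟩ := Metric.dense_iff.1 S.dense Q δ hδ0
    refine ⟨d (S.proj (e S.vac)), fun Φ Ψ hΦ hΨ => ?_⟩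
    have h1 := (hQ Φ hΦ).eventually (Metric.ball_mem_nhds Q hδ0)
    have h2 := (tendsto_integral_unitary S.mul₂ S.continuous₂ d (e S.vac) hΨ).eventually
      (Metric.ball_mem_nhds _ (show 0 < ε / 3 by positivity))
    filter_upwards [h1, h2] with n hn1 hn2
    set Qn := ∫ g, q g ∂(Φ n : Measure G) with hQn
    have hdA : doubleAverage (Φ n : Measure G) (Ψ n : Measure G)
        (fun g₁ g₂ => conjOp (S.U₂ g₂) e (q g₁)) =
        ∫ g, conjOp (S.U₂ g) e Qn ∂(Ψ n : Measure G) := by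
      unfold doubleAverage
      congr 1
      ext g₂
      exact (conjOp (S.U₂ g₂) e).integral_comp_comm
        (integrable_of_continuous_of_bounded hq hC _)
    have hvac : ∀ g, conjOp (S.U₂ g) e (d S.vac) = d (S.U₂ g (e S.vac)) := fun g => by
      rw [S.commute (S.conj₂_mem he g) hd, map_eq_conjOp, S.vac₂]
    have hQnd : ‖Qn - d S.vac‖ ≤ 2 * δ := by
      have := dist_triangle_right Qn (d S.vac) Q
      rw [dist_eq_norm] at this
      rw [Metric.mem_ball] at hdQ
      linarith
    have hi : ∀ x : H, Integrable (fun g => conjOp (S.U₂ g) e x) (Ψ n : Measure G) := fun x =>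
      integrable_of_continuous_of_bounded
        (continuous_conjOp_apply S.mul₂ S.continuous₂ e continuous_id continuous_const)
        (fun g => norm_conjOp_apply_le _ _ _) _
    have h3 : ‖∫ g, conjOp (S.U₂ g) e Qn ∂(Ψ n : Measure G) -
        ∫ g, d (S.U₂ g (e S.vac)) ∂(Ψ n : Measure G)‖ ≤ ‖e‖ * (2 * δ) := by
      simp only [← hvac]
      rw [← integral_sub (hi _) (hi _)]
      refine norm_integral_le_of_bounded (fun g => ?_) _
      rw [← map_sub]
      exact (norm_conjOp_apply_le _ _ _).trans
        (mul_le_mul_of_nonneg_left hQnd (norm_nonneg _))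
    have h4 : ‖e‖ * (2 * δ) ≤ 2 * (ε / 3) := by
      rw [hδ, ← mul_div_assoc, ← mul_div_assoc, ← mul_div_assoc,
        div_le_div_iff₀ (by positivity) (by positivity)]
      nlinarith [norm_nonneg e]
    rw [hdA]
    rw [dist_eq_norm] at hn2
    calc _ = ‖(∫ g, conjOp (S.U₂ g) e Qn ∂(Ψ n : Measure G) -
          ∫ g, d (S.U₂ g (e S.vac)) ∂(Ψ n : Measure G)) +
          (∫ g, d (S.U₂ g (e S.vac)) ∂(Ψ n : Measure G) - d (S.proj (e S.vac)))‖ := by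
            rw [sub_add_sub_cancel]
      _ ≤ ‖e‖ * (2 * δ) + ε / 3 := (norm_add_le _ _).trans (add_le_add h3 hn2.le)
      _ ≤ ε := by linarith

variable {Ψ : ℕ → ProbabilityMeasure G}

/-- Structured vectors: the dual functions `J_b^* η` with `η` a fixed vector. Approximating `η` by
combinations of elementary lifts separates the two group variables. -/
theorem hasReiterLimit_form_adjoint_lift (hΨ : IsLeftReiter Ψ) {f₁ f₂ b : H →L[ℂ] H}
    (h₁ : f₁ ∈ S.alg) (h₂ : f₂ ∈ S.alg) (hb : b ∈ S.alg)
    {η : UniformSpace.Completion (MeanSpace Ψ H)} (hη : ∀ g, S.rep Ψ g η = η)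
    (hηs : η ∈ S.liftSpan Ψ) :
    HasReiterLimit fun g₁ g₂ => S.form f₁ f₂ g₁ g₂ (adjoint (S.lift Ψ b) η) := by
  let Λ : G → G → UniformSpace.Completion (MeanSpace Ψ H) →L[ℂ] H := fun g₁ g₂ =>
    conjOp (S.U₁ g₁) f₁ ∘L conjOp (S.U₂ g₂) f₂ ∘L
      (S.U₂ g₂).toLinearIsometry.toContinuousLinearMap ∘L
      adjoint (S.lift Ψ (conjOp (S.U₁ g₁) b))
  have hΛ : ∀ g₁ g₂, ‖Λ g₁ g₂‖ ≤ ‖f₁‖ * (‖f₂‖ * ‖b‖) := fun g₁ g₂ =>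
    ContinuousLinearMap.opNorm_le_bound _ (by positivity) fun x => by
      rw [mul_assoc, mul_assoc]
      refine (norm_conjOp_apply_le _ _ _).trans (mul_le_mul_of_nonneg_left ?_ (norm_nonneg _))
      refine (norm_conjOp_apply_le _ _ _).trans (mul_le_mul_of_nonneg_left ?_ (norm_nonneg _))
      refine ((S.U₂ g₂).norm_map _).trans_le ?_
      refine ContinuousLinearMap.le_of_opNorm_le _ ?_ x
      rw [LinearIsometryEquiv.norm_map]
      exact (S.norm_lift_le Ψ _).trans (norm_conjOp_le _ _)
  have hΛη : (fun g₁ g₂ => S.form f₁ f₂ g₁ g₂ (adjoint (S.lift Ψ b) η)) =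
      fun g₁ g₂ => Λ g₁ g₂ η := by
    funext g₁ g₂
    rw [form_apply, S.U₁_adjoint_lift b hη]
    rfl
  have hspan : S.liftSpan Ψ ≤ HasReiterLimit.submodule Λ := by
    refine Submodule.topologicalClosure_minimal _ (Submodule.span_le.2 ?_)
      (HasReiterLimit.isClosed_submodule hΛ)
    rintro _ ⟨a, ha, c, hc, rfl⟩
    set ξ := S.lift Ψ (adjoint b) (f₁ S.vac) with hξ
    -- on an elementary lift the variables separate; the factor depending on the first one is an
    -- orbit of the lifted representation, seen through the adjoint of a lift
    have hq : ∀ g, adjoint (S.lift Ψ (adjoint a)) (S.rep Ψ g ξ) =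
        conjOp (S.U₁ g) f₁ (S.proj (conjOp (S.U₁ g) (adjoint b) (a S.vac))) := by
      intro g
      have hbg := S.conj₁_mem (S.adjoint_mem hb) g
      rw [hξ, S.rep_lift, map_eq_conjOp, S.vac₁, S.adjoint_lift_lift_vac hΨ hbg
        (S.adjoint_mem ha) (S.conj₁_mem h₁ g), ContinuousLinearMap.adjoint_adjoint,
        S.commute ha hbg]
    have hqc : Continuous fun g => adjoint (S.lift Ψ (adjoint a)) (S.rep Ψ g ξ) := by
      simp only [hq]
      exact continuous_conjOp_apply S.mul₁ S.continuous₁ f₁ continuous_id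
        (S.proj.continuous.comp (continuous_conjOp_apply S.mul₁ S.continuous₁ _ continuous_id
          continuous_const))
    obtain ⟨m, hm, hmξ⟩ := exists_fixed_of_isometries (S.rep Ψ) (S.rep_mul Ψ) ξ
    have hlim := S.hasReiterLimit_conjOp_of_tendsto (S.mul_mem h₂ hc) hqc
      (fun g => ContinuousLinearMap.le_opNorm_of_le _ ((S.rep Ψ g).norm_map ξ).le)
      fun Φ hΦ => tendsto_integral_of_fixed (S.rep_mul Ψ) hm hmξ _ hqc hΦ
    have hfun : (fun g₁ g₂ => conjOp (S.U₂ g₂) (f₂ ∘L c)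
        (adjoint (S.lift Ψ (adjoint a)) (S.rep Ψ g₁ ξ))) =
        fun g₁ g₂ => Λ g₁ g₂ (S.lift Ψ a (c S.vac)) := by
      funext g₁ g₂
      change _ = conjOp (S.U₁ g₁) f₁ (conjOp (S.U₂ g₂) f₂ (S.U₂ g₂
        (adjoint (S.lift Ψ (conjOp (S.U₁ g₁) b)) (S.lift Ψ a (c S.vac)))))
      rw [S.adjoint_lift_lift_vac hΨ ha (S.conj₁_mem hb g₁) hc, hq, map_eq_conjOp (S.U₂ g₂) c,
        S.U₂_proj, adjoint_conjOp, conjOp_comp, ContinuousLinearMap.comp_apply,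
        S.commute (S.conj₂_mem hc g₂) (S.conj₁_mem h₁ g₁),
        S.commute (S.conj₂_mem h₂ g₂) (S.conj₁_mem h₁ g₁)]
    rw [hfun] at hlim
    exact hlim
  rw [hΛη]
  exact hspan hηs

end CubicSystem

/-! ### Pseudorandom vectors and convergence of the trilinear averages -/

namespace CubicSystem

open ContinuousLinearMap (adjoint)

variable {G : Type*} [Group G] [TopologicalSpace G] [IsTopologicalGroup G]
  [SigmaCompactSpace G] [MeasurableSpace G] [BorelSpace G]
  {H : Type*} [NormedAddCommGroup H] [InnerProductSpace ℂ H] [CompleteSpace H]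
  (S : CubicSystem G H) {Ψ : ℕ → ProbabilityMeasure G}

/-- Bound for the double average by the averages of `f₁ (U₂ g₂ w)` over finitely many translates,
obtained from the Reiter property in the first variable. -/
theorem norm_doubleAverage_form_le {f₁ f₂ : H →L[ℂ] H} (h₁ : f₁ ∈ S.alg) (h₂ : f₂ ∈ S.alg) (w : H)
    (s : Finset G) (σ : G → ℝ) (hσ : ∀ h ∈ s, 0 ≤ σ h) (hσ1 : ∑ h ∈ s, σ h = 1)
    (φ ψ : Measure G) [IsProbabilityMeasure φ] [φ.Regular] [IsProbabilityMeasure ψ]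
    {ε : ℝ} (hε : 0 < ε) :
    ‖doubleAverage φ ψ fun g₁ g₂ => S.form f₁ f₂ g₁ g₂ w‖ ≤
      ‖f₂‖ * (‖f₁‖ * ‖w‖ * ∑ h ∈ s, σ h * translateDist h φ +
        ((∫ g, ‖∑ h ∈ s, σ h • conjOp (S.U₁ h) f₁ (S.U₂ g (S.U₁ h w))‖ ^ 2 ∂ψ) / ε + ε) / 2) := by
  set ρ : G → ℝ := fun g => ‖∑ h ∈ s, σ h • conjOp (S.U₁ h) f₁ (S.U₂ g (S.U₁ h w))‖ with hρ
  set τ := ∑ h ∈ s, σ h * translateDist h φ with hτ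
  have hρc : Continuous ρ := by
    refine (continuous_finsetSum s fun h _ => ?_).norm
    exact ((conjOp (S.U₁ h) f₁).continuous.comp (S.continuous₂ _)).const_smul _
  have hρb : ∀ g, ‖ρ g ^ 2‖ ≤ (∑ h ∈ s, σ h * (‖f₁‖ * ‖w‖)) ^ 2 := by
    intro g
    rw [norm_pow, Real.norm_of_nonneg (norm_nonneg _)]
    refine pow_le_pow_left₀ (norm_nonneg _) ((norm_sum_le _ _).trans
      (Finset.sum_le_sum fun h hh => ?_)) 2
    rw [norm_smul, Real.norm_of_nonneg (hσ h hh)]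
    refine mul_le_mul_of_nonneg_left ((norm_conjOp_apply_le _ _ _).trans_eq ?_) (hσ h hh)
    rw [LinearIsometryEquiv.norm_map, LinearIsometryEquiv.norm_map]
  have hρi : Integrable (fun g => ρ g ^ 2) ψ :=
    integrable_of_continuous_of_bounded (hρc.pow 2) hρb ψ
  have hinner : ∀ g₂, ‖∫ g₁, S.form f₁ f₂ g₁ g₂ w ∂φ‖ ≤
      ‖f₂‖ * (‖f₁‖ * ‖w‖ * τ + (ρ g₂ ^ 2 / ε + ε) / 2) := by
    intro g₂
    set y := f₁ (S.U₂ g₂ w) with hy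
    have hyb : ∀ g, ‖S.U₁ g y‖ ≤ ‖f₁‖ * ‖w‖ := fun g => by
      rw [LinearIsometryEquiv.norm_map]
      exact f₁.le_opNorm_of_le ((S.U₂ g₂).norm_map w).le
    have hpull : ∫ g₁, S.form f₁ f₂ g₁ g₂ w ∂φ =
        conjOp (S.U₂ g₂) f₂ (∫ g₁, S.U₁ g₁ y ∂φ) := by
      simp only [S.form_apply_eq_conjOp h₁ h₂]
      exact (conjOp (S.U₂ g₂) f₂).integral_comp_comm
        (integrable_of_continuous_of_bounded (S.continuous₁ y) hyb φ)
    have hshift := norm_integral_sum_translate_sub_le s σ hσ hσ1 φ (S.continuous₁ y) hyb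
    have havg : ‖∫ g, ∑ h ∈ s, σ h • S.U₁ (h * g) y ∂φ‖ ≤ ρ g₂ := by
      refine norm_integral_le_of_bounded (fun g => ?_) φ
      have : ∑ h ∈ s, σ h • S.U₁ (h * g) y =
          S.U₁ g (∑ h ∈ s, σ h • conjOp (S.U₁ h) f₁ (S.U₂ g₂ (S.U₁ h w))) := by
        rw [map_sum]
        refine Finset.sum_congr rfl fun h _ => ?_
        rw [S.mul₁, ← Complex.coe_smul, ← Complex.coe_smul, map_smul, hy, map_eq_conjOp (S.U₁ h),
          S.comm]
      rw [this, LinearIsometryEquiv.norm_map]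
    -- the bound is quadratic in `ρ` because the averages of `ρ ^ 2` are sums of correlations
    have hyoung : ρ g₂ ≤ (ρ g₂ ^ 2 / ε + ε) / 2 := by
      have h0 : ρ g₂ ^ 2 / ε + ε - 2 * ρ g₂ = (ρ g₂ - ε) ^ 2 / ε := by
        field_simp
        ring
      have : 0 ≤ (ρ g₂ - ε) ^ 2 / ε := by positivity
      linarith
    rw [hpull]
    refine (norm_conjOp_apply_le _ _ _).trans (mul_le_mul_of_nonneg_left ?_ (norm_nonneg _))
    rw [norm_sub_rev] at hshift
    have := norm_le_norm_add_norm_sub' (∫ g₁, S.U₁ g₁ y ∂φ)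
      (∫ g, ∑ h ∈ s, σ h • S.U₁ (h * g) y ∂φ)
    linarith
  have hρi₂ : Integrable (fun g => ρ g ^ 2 / ε + ε) ψ :=
    (hρi.div_const ε).add (integrable_const ε)
  have hρi₃ : Integrable (fun g => (ρ g ^ 2 / ε + ε) / 2) ψ := hρi₂.div_const 2
  refine (norm_integral_le_of_norm_le (((integrable_const _).add hρi₃).const_mul ‖f₂‖)
    (Eventually.of_forall hinner)).trans_eq ?_
  simp only [Pi.add_apply]
  rw [integral_const_mul, integral_add (integrable_const _) hρi₃, integral_div,
    integral_add (hρi.div_const ε) (integrable_const ε), integral_div,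
    integral_const, integral_const, probReal_univ, one_smul, one_smul]

variable [T2Space G]

/-- Pseudorandom vectors: those orthogonal to all dual functions. The finite averages of the orbit
of `J_{f₁} w` come close to the point of minimal norm of their closed convex hull; that point is
fixed, hence orthogonal to the orbit, hence zero. -/
theorem hasReiterLimit_form_of_orthogonal (hΨ : IsLeftReiter Ψ) {f₁ f₂ : H →L[ℂ] H}
    (h₁ : f₁ ∈ S.alg) (h₂ : f₂ ∈ S.alg) {w : H}
    (hw : ∀ η ∈ S.liftSpan Ψ, (∀ g, S.rep Ψ g η = η) → inner ℂ η (S.lift Ψ f₁ w) = 0) :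
    HasReiterLimit fun g₁ g₂ => S.form f₁ f₂ g₁ g₂ w := by
  obtain ⟨m, hm, hmξ⟩ := exists_fixed_of_isometries (S.rep Ψ) (S.rep_mul Ψ) (S.lift Ψ f₁ w)
  have hms : m ∈ S.liftSpan Ψ := by
    have hcl : IsClosed (S.liftSpan Ψ : Set (UniformSpace.Completion (MeanSpace Ψ H))) :=
      Submodule.isClosed_topologicalClosure _
    rw [← SetLike.mem_coe, ← hcl.closure_eq, Metric.mem_closure_iff]
    intro ε hε
    obtain ⟨s, σ, -, -, hs⟩ := hmξ ε hε
    refine ⟨_, ?_, by rwa [dist_comm, dist_eq_norm]⟩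
    refine Submodule.sum_mem _ fun h _ => ?_
    rw [S.rep_lift, ← Complex.coe_smul]
    exact Submodule.smul_mem _ _ (S.lift_mem_liftSpan (S.conj₁_mem h₁ h) _)
  have hm0 : m = 0 := by
    have := inner_eq_of_mem_closure_averages hm hmξ
    rw [hw m hms hm] at this
    exact inner_self_eq_zero.1 this.symm
  refine HasReiterLimit.of_tendsto (S.continuous_form_apply f₁ f₂ w)
    (fun g₁ g₂ => (S.form f₁ f₂ g₁ g₂).le_of_opNorm_le (S.norm_form_le f₁ f₂ g₁ g₂) w) 0
    fun Φ Ψ' hΦ hΨ' => ?_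
  rw [Metric.tendsto_nhds]
  intro ε hε
  set δ := ε / (2 * (‖f₂‖ + 1)) with hδ
  have hδ0 : 0 < δ := by positivity
  obtain ⟨s, σ, hσ, hσ1, hs⟩ := hmξ δ hδ0
  simp only [hm0, sub_zero, S.rep_lift] at hs
  have hτ := (hΦ.tendsto_sum_translateDist s σ).const_mul (‖f₁‖ * ‖w‖)
  have hN := S.tendsto_integral_norm_sq_sum hΨ s σ (a := fun h => conjOp (S.U₁ h) f₁)
    (fun h => S.conj₁_mem h₁ h) (fun h => S.U₁ h w) hΨ'
  have hs2 := pow_lt_pow_left₀ hs (norm_nonneg _) two_ne_zero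
  rw [mul_zero] at hτ
  filter_upwards [hτ.eventually (gt_mem_nhds hδ0), hN.eventually (gt_mem_nhds hs2)] with n hn1 hn2
  have := hΦ.regular n
  rw [dist_zero_right]
  refine (S.norm_doubleAverage_form_le h₁ h₂ w s σ hσ hσ1 (Φ n : Measure G) (Ψ' n : Measure G)
    hδ0).trans_lt ?_
  have h3 : (∫ g, ‖∑ h ∈ s, σ h • conjOp (S.U₁ h) f₁ (S.U₂ g (S.U₁ h w))‖ ^ 2
      ∂(Ψ' n : Measure G)) / δ ≤ δ := by
    rw [div_le_iff₀ hδ0, ← sq]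
    exact hn2.le
  calc _ ≤ ‖f₂‖ * (δ + (δ + δ) / 2) := by gcongr
    _ = 2 * ‖f₂‖ * δ := by ring
    _ < ε := by
        rw [hδ, mul_div_assoc', div_lt_iff₀ (by positivity)]
        nlinarith

/-- Every vector is a sum of a structured and a pseudorandom one. -/
theorem hasReiterLimit_form (hΨ : IsLeftReiter Ψ) {f₁ f₂ : H →L[ℂ] H} (h₁ : f₁ ∈ S.alg)
    (h₂ : f₂ ∈ S.alg) (v : H) : HasReiterLimit fun g₁ g₂ => S.form f₁ f₂ g₁ g₂ v := by
  set N := HasReiterLimit.submodule fun g₁ g₂ => S.form f₁ f₂ g₁ g₂ with hN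
  have hNc : IsClosed (N : Set H) := HasReiterLimit.isClosed_submodule (S.norm_form_le f₁ f₂)
  have : CompleteSpace N := hNc.completeSpace_coe
  have hbot : Nᗮ = ⊥ := by
    refine (Submodule.eq_bot_iff _).2 fun w hw => ?_
    have hwN : w ∈ N := S.hasReiterLimit_form_of_orthogonal hΨ h₁ h₂ fun η hη hfix => by
      rw [← ContinuousLinearMap.adjoint_inner_left]
      exact (Submodule.mem_orthogonal N w).1 hw _
        (S.hasReiterLimit_form_adjoint_lift hΨ h₁ h₂ h₁ hfix hη)
    exact inner_self_eq_zero.1 ((Submodule.mem_orthogonal N w).1 hw w hwN)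
  have hv : v ∈ N := by
    rw [Submodule.orthogonal_eq_bot_iff.1 hbot]
    exact Submodule.mem_top
  exact hv

end CubicSystem

/-! ### Strong continuity of the Koopman representation -/

section Koopman

open scoped symmDiff

variable {G : Type*} [TopologicalSpace G]
  {X : Type*} [TopologicalSpace X] [MeasurableSpace X] [BorelSpace X] {μ : Measure X}
  [IsFiniteMeasure μ] [μ.Regular]

/-- For an open set, inner regularity and the tube lemma show that nearby preimages have a large
intersection; since preimages have equal measure, this suffices. No separation axiom is needed. -/
theorem eventually_measure_symmDiff_preimage_isOpen_le {S : G → X → X}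
    (hS : Continuous fun p : G × X => S p.1 p.2) (hμ : ∀ g, MeasurePreserving (S g) μ μ)
    {U : Set X} (hU : IsOpen U) {ε : ℝ≥0∞} (hε : ε ≠ 0) (g₀ : G) :
    ∀ᶠ g in 𝓝 g₀, μ ((S g ⁻¹' U) ∆ (S g₀ ⁻¹' U)) ≤ ε + ε := by
  have hSc : ∀ g, Continuous (S g) := fun g => hS.comp (continuous_const.prodMk continuous_id)
  have hm : ∀ g, μ (S g ⁻¹' U) = μ U := fun g => (hμ g).measure_preimage hU.nullMeasurableSet
  obtain ⟨K, hKU, hK, hKm⟩ : ∃ K ⊆ S g₀ ⁻¹' U, IsCompact K ∧ μ U ≤ μ K + ε := by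
    by_cases h0 : μ U = 0
    · exact ⟨∅, Set.empty_subset _, isCompact_empty, by simp [h0]⟩
    · obtain ⟨K, hKU, hK, hKm⟩ := (hU.preimage (hSc g₀)).exists_lt_isCompact (μ := μ)
        (r := μ U - ε) (by
          rw [hm]
          exact ENNReal.sub_lt_self (measure_ne_top _ _) h0 hε)
      exact ⟨K, hKU, hK, tsub_le_iff_right.1 hKm.le⟩
  have hnear : ∀ᶠ g in 𝓝 g₀, ∀ x ∈ K, S g x ∈ U :=
    hK.eventually_forall_of_forall_eventually fun x hx =>
      hS.continuousAt.eventually (hU.mem_nhds (hKU hx))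
  filter_upwards [hnear] with g hg
  have key : ∀ A B : Set X, MeasurableSet B → μ A = μ U → K ⊆ A → K ⊆ B → μ (A \ B) ≤ ε := by
    intro A B hB hA hKA hKB
    have h1 := measure_sdiff_add_inter (μ := μ) A hB
    have h2 : μ (A \ B) + μ (A ∩ B) ≤ ε + μ (A ∩ B) := by
      rw [h1, hA, add_comm]
      exact hKm.trans (add_le_add_left (measure_mono (Set.subset_inter hKA hKB)) _)
    exact (ENNReal.add_le_add_iff_right (measure_ne_top _ _)).1 h2
  have hmeas : ∀ g, MeasurableSet (S g ⁻¹' U) := fun g => (hU.preimage (hSc g)).measurableSet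
  exact (measure_union_le _ _).trans (add_le_add
    (key _ _ (hmeas g₀) (hm g) hg hKU) (key _ _ (hmeas g) (hm g₀) hKU hg))

theorem tendsto_measure_symmDiff_preimage {S : G → X → X}
    (hS : Continuous fun p : G × X => S p.1 p.2) (hμ : ∀ g, MeasurePreserving (S g) μ μ)
    {s : Set X} (hs : MeasurableSet s) (g₀ : G) :
    Tendsto (fun g => μ ((S g ⁻¹' s) ∆ (S g₀ ⁻¹' s))) (𝓝 g₀) (𝓝 0) := by
  rw [ENNReal.tendsto_nhds_zero]
  intro ε hε
  have hε4 : ε / 4 ≠ 0 := (ENNReal.div_pos hε.ne' (by norm_num)).ne'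
  obtain ⟨U, hsU, hU, hUs⟩ := s.exists_isOpen_lt_add (μ := μ) (measure_ne_top _ _) hε4
  have hdiff : μ (U \ s) ≤ ε / 4 := by
    rw [measure_sdiff hsU hs.nullMeasurableSet (measure_ne_top _ _)]
    exact tsub_le_iff_left.2 hUs.le
  have hpre : ∀ g, μ (S g ⁻¹' (U \ s)) ≤ ε / 4 := fun g => by
    rwa [(hμ g).measure_preimage (hU.measurableSet.diff hs).nullMeasurableSet]
  filter_upwards [eventually_measure_symmDiff_preimage_isOpen_le hS hμ hU hε4 g₀] with g hg
  have hsub : (S g ⁻¹' s) ∆ (S g₀ ⁻¹' s) ⊆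
      (S g ⁻¹' U) ∆ (S g₀ ⁻¹' U) ∪ (S g ⁻¹' (U \ s) ∪ S g₀ ⁻¹' (U \ s)) := by
    intro x hx
    have h1 := @hsU (S g x)
    have h2 := @hsU (S g₀ x)
    simp only [Set.mem_symmDiff, Set.mem_union, Set.mem_preimage, Set.mem_sdiff] at hx ⊢
    tauto
  calc _ ≤ (ε / 4 + ε / 4) + (ε / 4 + ε / 4) :=
        (measure_mono hsub).trans ((measure_union_le _ _).trans (add_le_add hg
          ((measure_union_le _ _).trans (add_le_add (hpre g) (hpre g₀)))))
    _ = ε := by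
        rw [← two_mul, ← two_mul, ← mul_assoc]
        norm_num
        exact ENNReal.mul_div_cancel (by norm_num) (by norm_num)

theorem continuous_compMeasurePreserving {S : G → X → X}
    (hS : Continuous fun p : G × X => S p.1 p.2) (hμ : ∀ g, MeasurePreserving (S g) μ μ)
    (v : Lp ℂ 2 μ) : Continuous fun g => Lp.compMeasurePreserving (S g) (hμ g) v := by
  have h : Continuous fun p : G × Lp ℂ 2 μ => Lp.compMeasurePreserving (S p.1) (hμ p.1) p.2 := by
    refine continuous_prod_of_dense_continuous_lipschitzWith' _ 1
      (Lp.simpleFunc.dense (by norm_num)) (fun g => (Lp.isometry_compMeasurePreserving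
        (hμ g)).lipschitz) fun f hf => ?_
    lift f to Lp.simpleFunc ℂ 2 μ using hf
    induction f using Lp.simpleFunc.induction two_ne_zero ENNReal.ofNat_ne_top with
    | add hfp hgp _ ihf ihg => exact ihf.add ihg
    | @indicatorConst c s hs hνs =>
      dsimp only [Lp.simpleFunc.coe_indicatorConst, Lp.indicatorConstLp_compMeasurePreserving]
      exact continuous_indicatorConstLp_set (by norm_num) fun g =>
        tendsto_measure_symmDiff_preimage hS hμ hs g
  exact h.comp (continuous_id.prodMk continuous_const)

end Koopman

/-! ### Multiplication operators -/

section MulOp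

open ContinuousLinearMap (adjoint)

variable {X : Type*} [MeasurableSpace X] {μ : Measure X}

/-- Multiplication by a bounded function, as an operator on `L²`. -/
noncomputable def mulOp (f : Lp ℂ ∞ μ) : Lp ℂ 2 μ →L[ℂ] Lp ℂ 2 μ :=
  (ContinuousLinearMap.mul ℂ ℂ).holderL μ ∞ 2 2 f

theorem coeFn_mulOp (f : Lp ℂ ∞ μ) (v : Lp ℂ 2 μ) : mulOp f v =ᵐ[μ] fun x => f x * v x :=
  (ContinuousLinearMap.mul ℂ ℂ).coeFn_holder (r := 2) f v

theorem mulOp_comp_mem_range (f g : Lp ℂ ∞ μ) :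
    mulOp f ∘L mulOp g ∈ Set.range (mulOp (μ := μ)) := by
  refine ⟨(ContinuousLinearMap.mul ℂ ℂ).holder ∞ f g, ?_⟩
  ext1 v
  refine Lp.ext ?_
  filter_upwards [coeFn_mulOp f (mulOp g v), coeFn_mulOp g v, coeFn_mulOp _ v,
    (ContinuousLinearMap.mul ℂ ℂ).coeFn_holder (r := ∞) f g] with x h1 h2 h3 h4
  rw [h3, h4, ContinuousLinearMap.comp_apply, h1, h2, ContinuousLinearMap.mul_apply', mul_assoc]

theorem adjoint_mulOp (f : Lp ℂ ∞ μ) : adjoint (mulOp f) = mulOp (star f) := by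
  refine ((ContinuousLinearMap.eq_adjoint_iff _ _).2 fun v w => ?_).symm
  rw [L2.inner_def, L2.inner_def]
  refine integral_congr_ae ?_
  filter_upwards [coeFn_mulOp (star f) v, coeFn_mulOp f w, Lp.coeFn_star f] with x h1 h2 h3
  rw [h1, h2, h3]
  simp only [Pi.star_apply, RCLike.inner_apply, RCLike.star_def, map_mul,
    RingHomCompTriple.comp_apply, RingHom.id_apply]
  ring

theorem mulOp_commute (f g : Lp ℂ ∞ μ) (v : Lp ℂ 2 μ) :
    mulOp f (mulOp g v) = mulOp g (mulOp f v) := by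
  refine Lp.ext ?_
  filter_upwards [coeFn_mulOp f (mulOp g v), coeFn_mulOp g (mulOp f v), coeFn_mulOp g v,
    coeFn_mulOp f v] with x h1 h2 h3 h4
  rw [h1, h2, h3, h4, mul_left_comm]

theorem compMeasurePreserving_mulOp {S : X → X} (hS : MeasurePreserving S μ μ) (f : Lp ℂ ∞ μ)
    (v : Lp ℂ 2 μ) : Lp.compMeasurePreserving S hS (mulOp f v) =
      mulOp (Lp.compMeasurePreserving S hS f) (Lp.compMeasurePreserving S hS v) := by
  refine Lp.ext ?_
  filter_upwards [Lp.coeFn_compMeasurePreserving (mulOp f v) hS,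
    Lp.coeFn_compMeasurePreserving f hS, Lp.coeFn_compMeasurePreserving v hS,
    hS.quasiMeasurePreserving.ae_eq_comp (coeFn_mulOp f v), coeFn_mulOp _ _] with x h1 h2 h3 h4 h5
  rw [h1, h5, h2, h3, h4]
  rfl

variable [IsFiniteMeasure μ]

theorem dense_mulOp_const : Dense {v : Lp ℂ 2 μ | ∃ a ∈ Set.range (mulOp (μ := μ)),
    a (Lp.const 2 μ 1) = v} := by
  refine (Lp.simpleFunc.dense (E := ℂ) (μ := μ) (p := 2) (by norm_num)).mono fun v hv => ?_
  lift v to Lp.simpleFunc ℂ 2 μ using hv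
  refine ⟨_, ⟨(SimpleFunc.memLp_top (Lp.simpleFunc.toSimpleFunc v) μ).toLp _, rfl⟩, Lp.ext ?_⟩
  filter_upwards [coeFn_mulOp ((SimpleFunc.memLp_top (Lp.simpleFunc.toSimpleFunc v) μ).toLp _)
    (Lp.const 2 μ 1), Lp.coeFn_const (p := 2) (μ := μ) (1 : ℂ), MemLp.coeFn_toLp
    (SimpleFunc.memLp_top (Lp.simpleFunc.toSimpleFunc v) μ),
    Lp.simpleFunc.toSimpleFunc_eq_toFun v] with x h1 h2 h3 h4
  rw [h1, h2, h3, h4]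
  simp

theorem compMeasurePreserving_const {S : X → X} (hS : MeasurePreserving S μ μ) :
    Lp.compMeasurePreserving S hS (Lp.const 2 μ (1 : ℂ)) = Lp.const 2 μ 1 := by
  refine Lp.ext ?_
  filter_upwards [Lp.coeFn_compMeasurePreserving (Lp.const 2 μ (1 : ℂ)) hS,
    Lp.coeFn_const (p := 2) (μ := μ) (1 : ℂ),
    hS.quasiMeasurePreserving.ae_eq_comp (Lp.coeFn_const (p := 2) (μ := μ) (1 : ℂ))] with x h1 h2 h3
  rw [h1, h2, h3]
  rfl

end MulOp

/-! ### Cubic averages of a pair of commuting actions -/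

section CubicAverages

variable {G : Type*} [Group G] [TopologicalSpace G]
  {X : Type*} [TopologicalSpace X] [MeasurableSpace X] {μ : Measure X} {T : Fin 2 → G → X → X}

namespace IsCommutingSystem

/-- The unitary operator `f ↦ f ∘ T i g` on `L²`. -/
noncomputable def koopman (hT : IsCommutingSystem T μ) (i : Fin 2) (g : G) :
    Lp ℂ 2 μ ≃ₗᵢ[ℂ] Lp ℂ 2 μ :=
  LinearIsometryEquiv.ofSurjective
    (Lp.compMeasurePreservingₗᵢ ℂ (T i g) (hT.measurePreserving i g)) fun v => by
      refine ⟨Lp.compMeasurePreserving (T i g⁻¹) (hT.measurePreserving i g⁻¹) v, ?_⟩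
      change Lp.compMeasurePreserving (T i g) (hT.measurePreserving i g) _ = v
      refine Lp.ext ?_
      filter_upwards [Lp.coeFn_compMeasurePreserving (Lp.compMeasurePreserving (T i g⁻¹)
        (hT.measurePreserving i g⁻¹) v) (hT.measurePreserving i g),
        (hT.measurePreserving i g).quasiMeasurePreserving.ae_eq_comp
          (Lp.coeFn_compMeasurePreserving v (hT.measurePreserving i g⁻¹))] with x h1 h2
      rw [h1, h2, Function.comp_apply, Function.comp_apply, ← hT.mul, inv_mul_cancel, hT.one]

theorem coeFn_koopman (hT : IsCommutingSystem T μ) (i : Fin 2) (g : G) (v : Lp ℂ 2 μ) :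
    hT.koopman i g v =ᵐ[μ] fun x => v (T i g x) :=
  Lp.coeFn_compMeasurePreserving v (hT.measurePreserving i g)

theorem koopman_mul (hT : IsCommutingSystem T μ) (i : Fin 2) (g h : G) (v : Lp ℂ 2 μ) :
    hT.koopman i (g * h) v = hT.koopman i h (hT.koopman i g v) := by
  refine Lp.ext ?_
  filter_upwards [hT.coeFn_koopman i (g * h) v, hT.coeFn_koopman i h (hT.koopman i g v),
    (hT.measurePreserving i h).quasiMeasurePreserving.ae_eq_comp (hT.coeFn_koopman i g v)]
    with x h1 h2 h3
  rw [h1, h2]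
  rw [Function.comp_apply, Function.comp_apply] at h3
  rw [h3, hT.mul]

theorem koopman_comm (hT : IsCommutingSystem T μ) {i j : Fin 2} (hij : i ≠ j) (g h : G)
    (v : Lp ℂ 2 μ) :
    hT.koopman i g (hT.koopman j h v) = hT.koopman j h (hT.koopman i g v) := by
  refine Lp.ext ?_
  filter_upwards [hT.coeFn_koopman i g (hT.koopman j h v), hT.coeFn_koopman j h (hT.koopman i g v),
    (hT.measurePreserving i g).quasiMeasurePreserving.ae_eq_comp (hT.coeFn_koopman j h v),
    (hT.measurePreserving j h).quasiMeasurePreserving.ae_eq_comp (hT.coeFn_koopman i g v)]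
    with x h1 h2 h3 h4
  rw [Function.comp_apply, Function.comp_apply] at h3 h4
  rw [h1, h2, h3, h4, hT.comm i j hij]

theorem conjOp_koopman_mulOp (hT : IsCommutingSystem T μ) (i : Fin 2) (g : G) (f : Lp ℂ ∞ μ) :
    conjOp (hT.koopman i g) (mulOp f) =
      mulOp (Lp.compMeasurePreserving (T i g) (hT.measurePreserving i g) f) := by
  ext1 v
  obtain ⟨v, rfl⟩ := (hT.koopman i g).surjective v
  rw [← map_eq_conjOp]
  exact compMeasurePreserving_mulOp (hT.measurePreserving i g) f v

variable [BorelSpace X] [IsFiniteMeasure μ] [μ.Regular]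

/-- The operators associated with a pair of commuting actions: the two Koopman representations and
the multiplication operators. -/
noncomputable def cubicSystem (hT : IsCommutingSystem T μ) : CubicSystem G (Lp ℂ 2 μ) where
  U₁ := hT.koopman 0
  U₂ := hT.koopman 1
  mul₁ := hT.koopman_mul 0
  mul₂ := hT.koopman_mul 1
  continuous₁ := continuous_compMeasurePreserving (hT.continuous 0) (hT.measurePreserving 0)
  continuous₂ := continuous_compMeasurePreserving (hT.continuous 1) (hT.measurePreserving 1)
  comm := hT.koopman_comm (by decide)
  alg := Set.range mulOp
  mul_mem := by
    rintro _ _ ⟨f, rfl⟩ ⟨g, rfl⟩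
    exact mulOp_comp_mem_range f g
  adjoint_mem := by
    rintro _ ⟨f, rfl⟩
    exact ⟨star f, (adjoint_mulOp f).symm⟩
  commute := by
    rintro _ _ ⟨f, rfl⟩ ⟨g, rfl⟩
    exact mulOp_commute f g
  conj₁_mem := by
    rintro _ ⟨f, rfl⟩ g
    exact ⟨_, (hT.conjOp_koopman_mulOp 0 g f).symm⟩
  conj₂_mem := by
    rintro _ ⟨f, rfl⟩ g
    exact ⟨_, (hT.conjOp_koopman_mulOp 1 g f).symm⟩
  vac := Lp.const 2 μ 1
  vac₁ g := compMeasurePreserving_const (hT.measurePreserving 0 g)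
  vac₂ g := compMeasurePreserving_const (hT.measurePreserving 1 g)
  dense := dense_mulOp_const

theorem cubicProduct_eq_form (hT : IsCommutingSystem T μ) (f : Finset (Fin 2) → Lp ℂ ∞ μ)
    (g₁ g₂ : G) : cubicProduct hT f ![g₁, g₂] = mulOp (f ∅)
      (hT.cubicSystem.form (mulOp (f {0})) (mulOp (f {1})) g₁ g₂
        (mulOp (f {0, 1}) (Lp.const 2 μ 1))) := by
  have h0 := (hT.measurePreserving 0 g₁).quasiMeasurePreserving
  have h1 := (hT.measurePreserving 1 g₂).quasiMeasurePreserving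
  set w := mulOp (f {0, 1}) (Lp.const 2 μ 1) with hw
  set w' := hT.koopman 1 g₂ (hT.koopman 0 g₁ w)
  rw [CubicSystem.form_apply]
  change _ = mulOp (f ∅) (conjOp (hT.koopman 0 g₁) (mulOp (f {0}))
    (conjOp (hT.koopman 1 g₂) (mulOp (f {1})) w'))
  rw [hT.conjOp_koopman_mulOp, hT.conjOp_koopman_mulOp]
  set f₁ := Lp.compMeasurePreserving (T 0 g₁) (hT.measurePreserving 0 g₁) (f {0})
  set f₂ := Lp.compMeasurePreserving (T 1 g₂) (hT.measurePreserving 1 g₂) (f {1})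
  have hw1 : w =ᵐ[μ] fun x => f {0, 1} x := by
    filter_upwards [coeFn_mulOp (f {0, 1}) (Lp.const 2 μ 1),
      Lp.coeFn_const (p := 2) (μ := μ) (1 : ℂ)] with x h1 h2
    rw [h1, h2]
    simp
  have huniv : (Finset.univ : Finset (Finset (Fin 2))) = {∅, {0}, {1}, {0, 1}} := by decide
  refine Lp.ext ?_
  filter_upwards [(hT.memLp_prod f ![g₁, g₂]).coeFn_toLp,
    coeFn_mulOp (f ∅) (mulOp f₁ (mulOp f₂ w')),
    coeFn_mulOp f₁ (mulOp f₂ w'), coeFn_mulOp f₂ w',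
    Lp.coeFn_compMeasurePreserving (f {0}) (hT.measurePreserving 0 g₁),
    Lp.coeFn_compMeasurePreserving (f {1}) (hT.measurePreserving 1 g₂),
    hT.coeFn_koopman 1 g₂ (hT.koopman 0 g₁ w),
    h1.ae_eq_comp (hT.coeFn_koopman 0 g₁ w), (h0.comp h1).ae_eq_comp hw1]
    with x e1 e2 e3 e4 e5 e6 e7 e8 e9
  simp only [Function.comp_apply] at e5 e6 e7 e8 e9
  rw [cubicProduct, e1, e2, e3, e4, e5, e6, e7, e8, e9, huniv,
    Finset.prod_insert (by decide), Finset.prod_insert (by decide),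
    Finset.prod_insert (by decide), Finset.prod_singleton]
  simp [faceMap]

/-- The cubic products have a Reiter limit, as soon as there is a Reiter sequence. -/
theorem hasReiterLimit_cubicProduct [IsTopologicalGroup G] [T2Space G] [SigmaCompactSpace G]
    [MeasurableSpace G] [BorelSpace G] (hT : IsCommutingSystem T μ)
    (f : Finset (Fin 2) → Lp ℂ ∞ μ) {Φ : ℕ → ProbabilityMeasure G} (hΦ : IsLeftReiter Φ) :
    HasReiterLimit fun g₁ g₂ => cubicProduct hT f ![g₁, g₂] := by
  simp only [hT.cubicProduct_eq_form]
  exact (hT.cubicSystem.hasReiterLimit_form hΦ ⟨f {0}, rfl⟩ ⟨f {1}, rfl⟩ _).clm_comp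
    ((mulOp (f ∅)).restrictScalars ℝ)

end IsCommutingSystem

end CubicAverages

theorem mainTheorem4
    {G : Type*} [Group G] [TopologicalSpace G] [IsTopologicalGroup G] [T2Space G]
    [LocallyCompactSpace G] [SigmaCompactSpace G] [MeasurableSpace G] [BorelSpace G]
    {X : Type*} [TopologicalSpace X] [MeasurableSpace X] [BorelSpace X]
    (μ : Measure X) [IsProbabilityMeasure μ] [μ.Regular]
    (T : Fin 2 → G → X → X) (hT : IsCommutingSystem T μ)
    (f : Finset (Fin 2) → Lp ℂ ∞ μ) :
    (∀ Φ Ψ : ℕ → ProbabilityMeasure G, IsLeftReiter Φ → IsLeftReiter Ψ → ∀ n,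
      CubicAverageWellDefined hT f (Φ n : Measure G) (Ψ n : Measure G)) ∧
    ∃ L : Lp ℂ 2 μ, ∀ Φ Ψ : ℕ → ProbabilityMeasure G, IsLeftReiter Φ → IsLeftReiter Ψ →
      Tendsto (fun n => cubicAverage hT f (Φ n : Measure G) (Ψ n : Measure G)) atTop (𝓝 L) := by
  refine ⟨fun Φ Ψ hΦ hΨ n => ?_, ?_⟩
  · have h := hT.hasReiterLimit_cubicProduct f hΦ
    obtain ⟨C, hC⟩ := h.bounded
    have := hΦ.regular n
    exact ⟨fun g₂ => integrable_fst_of_bounded _ h.continuous hC g₂,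
      integrable_snd_of_bounded _ _ h.continuous hC⟩
  · by_cases hex : ∃ Φ : ℕ → ProbabilityMeasure G, IsLeftReiter Φ
    · obtain ⟨Φ, hΦ⟩ := hex
      exact (hT.hasReiterLimit_cubicProduct f hΦ).exists_tendsto hΦ
    · exact ⟨0, fun Φ _ hΦ => absurd ⟨Φ, hΦ⟩ hex⟩
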